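/- **DP-Fed-LS with Poisson client subsampling.** Let $d\ge 0$ be the model dimension. A client $j$ is given by the law of its mini-batches $\xi$ and by (measurable) stochastic mini-batch gradients $g_j^{i}(w,\xi)\in\mathbb R^d$, one for each local step $i$. A dataset $D$ is a finite set of clients; $D,D'$ are adjacent if $D'=D\cup\{a\}$ or $D'=D\setminus\{a\}$ for some client $a$. A randomized mechanism $\mathcal M$ that maps datasets to random vectors in $\mathbb R^d$ is $(\varepsilon,\delta)$-DP if $\mathbb P[\mathcal M(D)\in O]\le e^{\varepsilon}\,\mathbb P[\mathcal M(D')\in O]+\delta$ for all adjacent $D,D'$ and all measurable $O\subseteq\mathbb R^d$. Fix a sampling ratio $\tau\in(0,1]$, a number of communication rounds $T$, a clipping parameter $\mathcal L>0$, learning rates $\eta_l,\eta_g$, a number $K$ of local steps, a noise level $\nu$, an initial model $w^0$, weights $a_0,\dots,a_T\in[0,1]$ with $\sum_t a_t=1$, and normalizers $S_0,\dots,S_{T-1}>0$ (nominal numbers of active clients) which are public constants, i.e. do not depend on the dataset or on the sampling. Write $\mathrm{clip}(v,\mathcal L)=v/\max(1,\|v\|_2/\mathcal L)$. For $\sigma\ge0$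 let $\mathbf A_\sigma=\mathbf I+\sigma\mathbf L$, where $\mathbf L\in\mathbb R^{d\times d}$ is the Laplacian matrix of the cycle graph, $(\mathbf L v)_i=2v_i-v_{i+1}-v_{i-1}$ with indices mod $d$. On the dataset $D$, DP-Fed-LS runs for $t=0,\dots,T-1$ as follows, with fresh independent randomness in every round: 1. each client of $D$ is included in the active set $\mathcal S_t$ independently with probability $\tau$; 2. each $j\in\mathcal S_t$ draws its mini-batches $\xi_j^t$, sets $w_j^{t,0}=w^t$ and $w_j^{t,i+1}=w^t+\mathrm{clip}\big(w_j^{t,i}-\eta_l\,g_j^{i}(w_j^{t,i},\xi_j^t)-w^t,\ \mathcal L\big)$ for $0\le i<K$, and returns $\Delta_j^t=w_j^{t,K}-w^t$; 3. $w^{t+1}=w^t+\frac{\eta_g}{S_t}\mathbf A_\sigma^{-1}\Big(\sum_{j\in\mathcal S_t}\Delta_j^t+\mathbf n_t\Big)$ with $\mathbf n_t\sim\mathcal N(\mathbf 0,\nu^2\mathbf I)$. Its output is $\bar w^T=\sum_{t=0}^T a_t w^t$. DP-Fed is the same procedure with $\mathbf I$ in place of $\mathbf A_\sigma^{-1}$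 (that is, $\sigma=0$). **Theorem.** Let $\varepsilon>0$ and $\delta\in(0,1)$. Suppose that there is $\lambda\in(0,1)$ such that, with $\alpha=\frac{\log(1/\delta)}{(1-\lambda)\varepsilon}+1$, $$\nu\ \ge\ \frac{\tau\mathcal L}{\varepsilon}\sqrt{\frac{2T}{\lambda}\Big(\frac{\log(1/\delta)}{1-\lambda}+\varepsilon\Big)},\qquad \frac{\nu^2}{\mathcal L^2}\ \ge\ \frac59,\qquad \alpha-1\ \le\ \frac{2\nu^2}{3\mathcal L^2}\,\log\frac{1}{\tau\,\alpha\,(1+\nu^2/\mathcal L^2)} .$$ Then DP-Fed is $(\varepsilon,\delta)$-DP, and for every $\sigma\ge0$ DP-Fed-LS is $(\varepsilon,\delta)$-DP. -/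

import Mathlib

open MeasureTheory ProbabilityTheory

noncomputable section

namespace DPFedLS

/-- The parameter space `ℝ^d` with the Euclidean norm. -/
abbrev Model (d : ℕ) : Type := EuclideanSpace ℝ (Fin d)

/-! ### Differential privacy -/

open scoped Classical in
/-- Add/remove adjacency of finite sets of clients: `D' = D ∪ {a}` or `D' = D \ {a}`. -/
def Adjacent {C : Type*} (D D' : Finset C) : Prop :=
  ∃ a : C, D' = insert a D ∨ D' = D.erase a

/-- `(ε, δ)`-differential privacy of a randomized mechanism, given by its output laws,
with respect to add/remove adjacency. -/
def IsDP {C E : Type*} [MeasurableSpace E] (M : Finset C → Measure E) (ε δ : ℝ) : Prop :=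
  ∀ D D' : Finset C, Adjacent D D' → ∀ O : Set E, MeasurableSet O →
    M D O ≤ ENNReal.ofReal (Real.exp ε) * M D' O + ENNReal.ofReal δ

/-! ### Laplacian smoothing -/

/-- Laplacian of the cycle graph on `d` vertices, `∇ᵀ∇` for the periodic forward difference `∇`.
For `d ≥ 3` it is the circulant matrix with first row `(2, -1, 0, …, 0, -1)`. -/
def cycleLaplacian (d : ℕ) : Matrix (Fin d) (Fin d) ℝ :=
  Matrix.of fun i j =>
    (if i = j then 2 else 0) - (if (i.val + 1) % d = j.val then 1 else 0)
      - (if (j.val + 1) % d = i.val then 1 else 0)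

/-- The smoothing matrix `A_σ = I + σ L`. -/
def smoothingMatrix (d : ℕ) (σ : ℝ) : Matrix (Fin d) (Fin d) ℝ :=
  1 + σ • cycleLaplacian d

/-! ### Clients and local training -/

/-- A client. In every round it draws its mini-batches `ξ` from `batchLaw`; `grad i w ξ` is the
mini-batch gradient of its loss at the model `w` in the local step `i`. -/
structure Client (d : ℕ) (Ξ : Type*) [MeasurableSpace Ξ] where
  batchLaw : ProbabilityMeasure Ξ
  grad : ℕ → Model d → Ξ → Model d
  measurable_grad : ∀ i, Measurable fun p : Model d × Ξ => grad i p.1 p.2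

/-- Parameters of the federated training procedure. -/
structure Params (d : ℕ) where
  /-- client fraction (sampling ratio) -/
  τ : unitInterval
  /-- number of communication rounds -/
  T : ℕ
  /-- clipping parameter -/
  clipRadius : ℝ
  /-- local learning rate -/
  ηl : ℝ
  /-- global learning rate -/
  ηg : ℝ
  /-- noise level -/
  ν : ℝ
  /-- number of local steps -/
  localSteps : ℕ
  /-- public normalizer of the aggregate in round `t` (nominal number of active clients) -/
  S : ℕ → ℝ
  /-- initial model -/
  w₀ : Model d
  /-- averaging weights of the output -/
  a : ℕ → ℝ

/-- `clip(v, R) = v / max(1, ‖v‖ / R)`. -/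
def clip {d : ℕ} (v : Model d) (R : ℝ) : Model d :=
  (max 1 (‖v‖ / R))⁻¹ • v

variable {d : ℕ} {Ξ : Type*} [MeasurableSpace Ξ] {C : Type*}

/-- The local model after `i` local steps, from the global model `w` with mini-batches `ξ`. -/
def localModel (P : Params d) (c : Client d Ξ) (w : Model d) (ξ : Ξ) : ℕ → Model d
  | 0 => w
  | i + 1 =>
      w + clip (localModel P c w ξ i - P.ηl • c.grad i (localModel P c w ξ i) ξ - w) P.clipRadius

/-- The update returned by a client to the server. -/
def clientUpdate (P : Params d) (c : Client d Ξ) (w : Model d) (ξ : Ξ) : Model d :=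
  localModel P c w ξ P.localSteps - w

/-! ### The server -/

/-- The law `N(0, ν² I)` on `ℝ^d`. -/
def gaussianNoise (d : ℕ) (ν : ℝ) : Measure (Model d) :=
  (Measure.pi fun _ : Fin d => gaussianReal 0 (Real.toNNReal (ν ^ 2))).map (WithLp.toLp 2)

instance (d : ℕ) (ν : ℝ) : IsProbabilityMeasure (gaussianNoise d ν) :=
  Measure.isProbabilityMeasure_map (by fun_prop)

/-- The randomness of one round with client set `D`: for every client whether it is active and its
mini-batches, and the Gaussian noise of the server. -/
abbrev Seed (d : ℕ) (Ξ : Type*) (D : Finset C) : Type _ := (D → Bool × Ξ) × Model d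

/-- The law of the randomness of one round: every client is active with probability `τ`
(Poisson subsampling), and all the random choices are independent. -/
def seedLaw (P : Params d) (client : C → Client d Ξ) (D : Finset C) : Measure (Seed d Ξ D) :=
  (Measure.pi fun j : D =>
    (bernoulliMeasure true false P.τ).prod ((client j).batchLaw : Measure Ξ)).prod
      (gaussianNoise d P.ν)

instance (P : Params d) (client : C → Client d Ξ) (D : Finset C) :
    IsProbabilityMeasure (seedLaw P client D) := by
  unfold seedLaw; infer_instance

/-- The set of active clients. -/
def activeClients {D : Finset C} (r : Seed d Ξ D) : Finset D :=
  Finset.univ.filter fun j => (r.1 j).1 = true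

/-- The global model after `t` rounds, where the matrix `B` is applied to the noisy aggregate and
`ω t` is the randomness of round `t`. -/
def globalModel (P : Params d) (B : Matrix (Fin d) (Fin d) ℝ) (client : C → Client d Ξ)
    (D : Finset C) (ω : ℕ → Seed d Ξ D) : ℕ → Model d
  | 0 => P.w₀
  | t + 1 =>
      globalModel P B client D ω t + (P.ηg / P.S t) • Matrix.toEuclideanLin B
        ((∑ j ∈ activeClients (ω t),
            clientUpdate P (client j) (globalModel P B client D ω t) ((ω t).1 j).2) + (ω t).2)

/-- The output `∑_{t=0}^T a_t w^t`. -/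
def output (P : Params d) (B : Matrix (Fin d) (Fin d) ℝ) (client : C → Client d Ξ)
    (D : Finset C) (ω : ℕ → Seed d Ξ D) : Model d :=
  ∑ t ∈ Finset.range (P.T + 1), P.a t • globalModel P B client D ω t

/-- The law of the output, with independent randomness in the rounds. -/
def outputLaw (P : Params d) (B : Matrix (Fin d) (Fin d) ℝ) (client : C → Client d Ξ)
    (D : Finset C) : Measure (Model d) :=
  (Measure.infinitePi fun _ : ℕ => seedLaw P client D).map (output P B client D)

/-- DP-Fed with Poisson subsampling, as a mechanism on finite sets of clients. -/
def dpFed (P : Params d) (client : C → Client d Ξ) : Finset C → Measure (Model d) :=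
  outputLaw P 1 client

/-- DP-Fed-LS with Poisson subsampling: the noisy aggregate is multiplied by `A_σ⁻¹`. -/
def dpFedLS (P : Params d) (σ : ℝ) (client : C → Client d Ξ) : Finset C → Measure (Model d) :=
  outputLaw P (smoothingMatrix d σ)⁻¹ client

/-! ### The output is a random variable -/

theorem measurable_localModel (P : Params d) (c : Client d Ξ) (i : ℕ) :
    Measurable fun p : Model d × Ξ => localModel P c p.1 p.2 i := by
  induction i with
  | zero => exact measurable_fst
  | succ i ih =>
    have hg : Measurable fun p : Model d × Ξ => c.grad i (localModel P c p.1 p.2 i) p.2 := by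
      have hp : Measurable fun p : Model d × Ξ => (localModel P c p.1 p.2 i, p.2) :=
        ih.prodMk measurable_snd
      have h := (c.measurable_grad i).comp hp
      exact h
    have hv : Measurable fun p : Model d × Ξ =>
        localModel P c p.1 p.2 i - P.ηl • c.grad i (localModel P c p.1 p.2 i) p.2 - p.1 := by
      have h := hg.const_smul P.ηl
      exact (ih.sub h).sub measurable_fst
    have hn : Measurable fun p : Model d × Ξ =>
        (max 1 (‖localModel P c p.1 p.2 i - P.ηl • c.grad i (localModel P c p.1 p.2 i) p.2 - p.1‖
          / P.clipRadius))⁻¹ :=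
      (measurable_const.max (hv.norm.div_const _)).inv
    simp only [localModel, clip]
    exact measurable_fst.add (hn.smul hv)

theorem measurable_globalModel (P : Params d) (B : Matrix (Fin d) (Fin d) ℝ)
    (client : C → Client d Ξ) (D : Finset C) (t : ℕ) :
    Measurable fun ω : ℕ → Seed d Ξ D => globalModel P B client D ω t := by
  induction t with
  | zero => exact measurable_const
  | succ t ih =>
    have hB : Measurable (Matrix.toEuclideanLin B) :=
      (Matrix.toEuclideanLin B).continuous_of_finiteDimensional.measurable
    have hn : Measurable fun ω : ℕ → Seed d Ξ D => (ω t).2 := by fun_prop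
    have hsum : Measurable fun ω : ℕ → Seed d Ξ D => ∑ j ∈ activeClients (ω t),
        clientUpdate P (client j) (globalModel P B client D ω t) ((ω t).1 j).2 := by
      simp only [activeClients, Finset.sum_filter]
      refine Finset.measurable_sum _ fun j _ => Measurable.ite ?_ ?_ measurable_const
      · have hb : Measurable fun ω : ℕ → Seed d Ξ D => ((ω t).1 j).1 := by fun_prop
        exact hb (measurableSet_singleton true)
      · have hx : Measurable fun ω : ℕ → Seed d Ξ D => ((ω t).1 j).2 := by fun_prop
        exact ((measurable_localModel P (client j) P.localSteps).comp (ih.prodMk hx)).sub ih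
    have hs := (hB.comp (hsum.add hn)).const_smul (P.ηg / P.S t)
    simp only [globalModel]
    exact ih.add hs

theorem measurable_output (P : Params d) (B : Matrix (Fin d) (Fin d) ℝ)
    (client : C → Client d Ξ) (D : Finset C) : Measurable (output P B client D) := by
  unfold output
  refine Finset.measurable_sum _ fun t _ => ?_
  have h := (measurable_globalModel P B client D t).const_smul (P.a t)
  exact h

end DPFedLS

end

/-!
Client-level privacy of DP-Fed and DP-Fed-LS with Poisson subsampling, by Rényi-type moments of
the privacy loss.

Let `D'` have one client `a` more than `D`. In every round reveal the choices of the clients of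
`D`, the mini-batches of `a`, and the Gaussian noise together with the contribution of `a`. The
new model is a function of the old one and of these data, whatever matrix is applied to the noisy
aggregate, so it suffices to treat the revealed data. They have the same law on `D` and on `D'`
except that the centred Gaussian vector on `D` is replaced on `D'` by the mixture
`(1 - τ) N(0, ν² I) + τ N(Δ, ν² I)`, where the update `Δ` of `a` has norm at most `𝓛` by clipping.
The likelihood ratio of a round is therefore `u = 1 + τ (r - 1)`, with `r` the likelihood ratio of
two Gaussians (`lintegral_roundMap`, `lintegral_roundMap_insert`).

With `x = 𝓛² / ν² ≤ 9 / 5`, both `E[u ^ α]` and `E[u ^ (1 - α)]` are at most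
`exp (2 α (α - 1) τ² x)`. For the first, a second-order Taylor bound (`rpow_le_quadratic`) reduces
to `E[(r - 1)² max 1 (u ^ (α - 2))] ≤ 4 x`; the main part is `E[(r - 1)²] ≤ e ^ x - 1 ≤ 2.81 x`,
and the condition on `α` and `τ` makes the rest fit (`SubsamplingRegime.dominated`). The order `α`
is real, so a binomial expansion is not available. The moment of order `1 - α` is at most the one
of order `α`, by the reflection that exchanges the two Gaussians (`reflected_rpow_le`,
`lintegral_comp_likelihoodRatio`).

The bounds hold conditionally on the past, so they multiply over the rounds
(`PrivacyLossBound.step`, `privacyLossBound_stateLaw`). Markov's inequality for the privacy loss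
gives `(ε, exp (2 T α (α - 1) τ² x - (α - 1) ε))`-privacy in both directions
(`PrivacyLossBound.le`), and the lower bound on `ν` makes the second parameter at most `δ`
(`calibration`).
-/

noncomputable section

namespace DPFedLS

/-! ### Elementary inequalities for the moments of the likelihood ratio -/

theorem convexOn_of_hasDerivAt2_nonneg {D : Set ℝ} (hD : Convex ℝ D) {f f' f'' : ℝ → ℝ}
    (h1 : ∀ x ∈ D, HasDerivAt f (f' x) x) (h2 : ∀ x ∈ D, HasDerivAt f' (f'' x) x)
    (h3 : ∀ x ∈ interior D, 0 ≤ f'' x) : ConvexOn ℝ D f :=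
  convexOn_of_hasDerivWithinAt2_nonneg hD
    (fun x hx => (h1 x hx).continuousAt.continuousWithinAt)
    (fun x hx => (h1 x (interior_subset hx)).hasDerivWithinAt)
    (fun x hx => (h2 x (interior_subset hx)).hasDerivWithinAt) h3

/-- Second-order Taylor bound of `u ^ α` at `1`. The maximum bounds `ξ ^ (α - 2)` for all `ξ`
between `1` and `u`, whatever the sign of `α - 2`. -/
theorem rpow_le_quadratic {α u : ℝ} (hα : 1 ≤ α) (hu : 0 < u) :
    u ^ α ≤ 1 + α * (u - 1) + α * (α - 1) / 2 * ((u - 1) ^ 2 * max 1 (u ^ (α - 2))) := by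
  set M := max 1 (u ^ (α - 2)) with hM
  have hpos : ∀ z ∈ Set.Icc (min 1 u) (max 1 u), 0 < z := fun z hz =>
    (lt_min one_pos hu).trans_le hz.1
  have hbound : ∀ z ∈ Set.Icc (min 1 u) (max 1 u), z ^ (α - 2) ≤ M := by
    intro z hz
    have hz0 := hpos z hz
    rcases le_total 2 α with h2 | h2
    · have : z ^ (α - 2) ≤ (max 1 u) ^ (α - 2) :=
        Real.rpow_le_rpow hz0.le hz.2 (by linarith)
      refine this.trans ?_
      rcases le_total 1 u with h | h
      · rw [max_eq_right h]; exact le_max_right _ _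
      · rw [max_eq_left h, Real.one_rpow]; exact le_max_left _ _
    · have : z ^ (α - 2) ≤ (min 1 u) ^ (α - 2) :=
        Real.rpow_le_rpow_of_nonpos (lt_min one_pos hu) hz.1 (by linarith)
      refine this.trans ?_
      rcases le_total 1 u with h | h
      · rw [min_eq_left h, Real.one_rpow]; exact le_max_left _ _
      · rw [min_eq_right h]; exact le_max_right _ _
  let φ : ℝ → ℝ := fun z => 1 + α * (z - 1) + α * (α - 1) / 2 * M * (z - 1) ^ 2 - z ^ α
  have hφ : ∀ z, 0 < z → HasDerivAt φ (α + α * (α - 1) * M * (z - 1) - α * z ^ (α - 1)) z := by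
    intro z hz
    have h1 := ((hasDerivAt_id z).sub_const 1).const_mul α
    have h2 := (((hasDerivAt_id z).sub_const 1).pow 2).const_mul (α * (α - 1) / 2 * M)
    have h3 := Real.hasDerivAt_rpow_const (x := z) (p := α) (Or.inl hz.ne')
    refine (((h1.const_add 1).add h2).sub h3).congr_deriv ?_
    simp; ring
  have hφ' : ∀ z, 0 < z → HasDerivAt
      (fun z => α + α * (α - 1) * M * (z - 1) - α * z ^ (α - 1))
      (α * (α - 1) * (M - z ^ (α - 2))) z := by
    intro z hz
    have h1 := ((hasDerivAt_id z).sub_const 1).const_mul (α * (α - 1) * M)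
    have h3 := (Real.hasDerivAt_rpow_const (x := z) (p := α - 1) (Or.inl hz.ne')).const_mul α
    refine ((h1.const_add α).sub h3).congr_deriv ?_
    rw [show α - 1 - 1 = α - 2 by ring]; ring
  have hconv : ConvexOn ℝ (Set.Icc (min 1 u) (max 1 u)) φ := by
    refine convexOn_of_hasDerivAt2_nonneg (convex_Icc _ _) (fun z hz => hφ z (hpos z hz))
      (fun z hz => hφ' z (hpos z hz)) fun z hz => ?_
    have := hbound z (interior_subset hz)
    exact mul_nonneg (mul_nonneg (by linarith) (by linarith)) (by linarith)
  have h1mem : (1 : ℝ) ∈ Set.Icc (min 1 u) (max 1 u) := ⟨min_le_left _ _, le_max_left _ _⟩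
  have humem : u ∈ Set.Icc (min 1 u) (max 1 u) := ⟨min_le_right _ _, le_max_right _ _⟩
  have hd : HasDerivAt φ 0 1 := (hφ 1 one_pos).congr_deriv (by simp)
  have hφ1 : φ 1 = 0 := by simp [φ]
  have key : 0 ≤ φ u := by
    rcases lt_trichotomy 1 u with h | h | h
    · have := hconv.le_slope_of_hasDerivAt h1mem humem h hd
      rw [slope_def_field, hφ1, sub_zero, le_div_iff₀ (by linarith)] at this
      linarith
    · rw [← h, hφ1]
    · have := hconv.slope_le_of_hasDerivAt humem h1mem h hd
      rw [slope_def_field, hφ1, div_le_iff₀ (by linarith)] at this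
      linarith
  simp only [φ] at key
  linarith

/-- The function `u ^ α - u ^ (1 - α)` is convex on `[1, ∞)` and vanishes at `1`, so its quotient
by `u - 1` is increasing there. -/
theorem rpow_sub_rpow_mul_le {α u v : ℝ} (hα : 1 ≤ α) (hv : 1 ≤ v) (hvu : v ≤ u) :
    (v ^ α - v ^ (1 - α)) * (u - 1) ≤ (u ^ α - u ^ (1 - α)) * (v - 1) := by
  have hconv : ConvexOn ℝ (Set.Ici (1 : ℝ)) (fun z => z ^ α - z ^ (1 - α)) := by
    refine convexOn_of_hasDerivAt2_nonneg (convex_Ici _)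
      (f' := fun z => α * z ^ (α - 1) - (1 - α) * z ^ (-α))
      (f'' := fun z => α * (α - 1) * (z ^ (α - 2) - z ^ (-α - 1))) ?_ ?_ ?_
    · intro z hz
      have hz0 : z ≠ 0 := (one_pos.trans_le hz).ne'
      have h1 := Real.hasDerivAt_rpow_const (x := z) (p := α) (Or.inl hz0)
      have h2 := Real.hasDerivAt_rpow_const (x := z) (p := 1 - α) (Or.inl hz0)
      refine (h1.sub h2).congr_deriv ?_
      rw [show 1 - α - 1 = -α by ring]
    · intro z hz
      have hz0 : z ≠ 0 := (one_pos.trans_le hz).ne'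
      have h1 := (Real.hasDerivAt_rpow_const (x := z) (p := α - 1) (Or.inl hz0)).const_mul α
      have h2 := (Real.hasDerivAt_rpow_const (x := z) (p := -α) (Or.inl hz0)).const_mul (1 - α)
      refine (h1.sub h2).congr_deriv ?_
      rw [show α - 1 - 1 = α - 2 by ring]; ring
    · intro z hz
      have hz1 : (1 : ℝ) ≤ z := interior_subset hz
      have := Real.rpow_le_rpow_of_exponent_le hz1 (show -α - 1 ≤ α - 2 by linarith)
      exact mul_nonneg (mul_nonneg (by linarith) (by linarith)) (by linarith)
  rcases eq_or_lt_of_le hv with h | h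
  · subst h; simp
  have hu : 1 < u := h.trans_le hvu
  have := hconv.2 (Set.mem_Ici.2 le_rfl) (Set.mem_Ici.2 hu.le)
    (show 0 ≤ (u - v) / (u - 1) from div_nonneg (by linarith) (by linarith))
    (show 0 ≤ (v - 1) / (u - 1) from div_nonneg (by linarith) (by linarith))
    (by rw [← add_div, div_eq_one_iff_eq (by linarith)]; ring)
  have hne : u - 1 ≠ 0 := by linarith
  have hcomb : ((u - v) / (u - 1)) • (1 : ℝ) + ((v - 1) / (u - 1)) • u = v := by
    simp only [smul_eq_mul]; field_simp; ring
  rw [hcomb] at this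
  simp only [Real.one_rpow, sub_self, smul_eq_mul, mul_zero, zero_add] at this
  rw [div_mul_eq_mul_div, le_div_iff₀ (by linarith)] at this
  linarith

/-- The pointwise comparison behind the fact that, after averaging over a reflection that
exchanges the two likelihood ratios `r` and `1 / r`, the moment of order `1 - α` of the mixture
ratio `1 - τ + τ r` is at most its moment of order `α`. -/
theorem reflected_rpow_le {α τ r : ℝ} (hα : 1 ≤ α) (hτ0 : 0 ≤ τ) (hτ1 : τ < 1) (hr : 0 < r) :
    (1 - τ + τ * r) ^ (1 - α) + r * (1 - τ + τ * r⁻¹) ^ (1 - α) ≤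
      (1 - τ + τ * r) ^ α + r * (1 - τ + τ * r⁻¹) ^ α := by
  wlog h1r : 1 ≤ r generalizing r
  · have hr' : 1 ≤ r⁻¹ := (one_le_inv₀ hr).2 (le_of_not_ge h1r)
    have := mul_le_mul_of_nonneg_left (this (inv_pos.2 hr) hr') hr.le
    rw [inv_inv] at this
    rw [mul_add, mul_add, mul_inv_cancel_left₀ hr.ne', mul_inv_cancel_left₀ hr.ne'] at this
    linarith
  set u := 1 - τ + τ * r with hu
  set u' := 1 - τ + τ * r⁻¹ with hu'
  have hri : r⁻¹ ≤ 1 := inv_le_one_of_one_le₀ h1r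
  have hrr : r * r⁻¹ = 1 := mul_inv_cancel₀ hr.ne'
  have hu1 : 1 ≤ u := by nlinarith
  have hu'0 : 0 < u' := by
    have : 0 ≤ τ * r⁻¹ := mul_nonneg hτ0 (inv_nonneg.2 hr.le)
    linarith
  have hu'1 : u' ≤ 1 := by nlinarith
  set v := u'⁻¹ with hv
  have hv1 : 1 ≤ v := (one_le_inv₀ hu'0).2 hu'1
  have hvpos : 0 < v := by linarith
  have hu'v : u' = v⁻¹ := by rw [hv, inv_inv]
  have hprod : 1 ≤ u * u' := by
    have h2 : 2 ≤ r + r⁻¹ := by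
      have : 0 ≤ (r - 1) * (1 - r⁻¹) := mul_nonneg (by linarith) (by linarith)
      nlinarith
    have : u * u' = (1 - τ) ^ 2 + τ ^ 2 * (r * r⁻¹) + τ * (1 - τ) * (r + r⁻¹) := by
      rw [hu, hu']; ring
    rw [this, hrr]
    nlinarith [mul_le_mul_of_nonneg_left h2 (mul_nonneg hτ0 (by linarith : 0 ≤ 1 - τ))]
  have hvu : v ≤ u := by
    rw [hv, inv_le_iff_one_le_mul₀ hu'0]; exact hprod
  have hk := rpow_sub_rpow_mul_le hα hv1 hvu
  have hrel : r * (1 - u') = u - 1 := by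
    rw [hu, hu']; linear_combination (-τ) * hrr
  have hvv : v * u' = 1 := by rw [hv]; exact inv_mul_cancel₀ hu'0.ne'
  -- inversion turns `v ^ α - v ^ (1 - α)` into its negative divided by `v`
  have e1 : u' ^ α = u' * v ^ (1 - α) := by
    rw [hu'v, Real.inv_rpow hvpos.le, ← Real.rpow_neg hvpos.le,
      show -α = -1 + (1 - α) by ring, Real.rpow_add hvpos, Real.rpow_neg_one]
  have e2 : u' ^ (1 - α) = u' * v ^ α := by
    rw [hu'v, Real.inv_rpow hvpos.le, ← Real.rpow_neg hvpos.le,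
      show -(1 - α) = -1 + α by ring, Real.rpow_add hvpos, Real.rpow_neg_one]
  rcases eq_or_lt_of_le hu1 with h | h
  · have hu'e : u' = 1 := by
      have : r * (1 - u') = 0 := by rw [hrel, ← h]; ring
      rcases mul_eq_zero.1 this with h0 | h0
      · exact absurd h0 hr.ne'
      · linarith
    rw [← h, hu'e]; simp
  · have hru : r * u' * (v - 1) = u - 1 := by rw [← hrel]; linear_combination r * hvv
    have := mul_le_mul_of_nonneg_left hk (mul_nonneg hr.le hu'0.le)
    have h3 : r * u' * (v ^ α - v ^ (1 - α)) ≤ u ^ α - u ^ (1 - α) := by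
      refine le_of_mul_le_mul_right ?_ (sub_pos.2 h)
      calc r * u' * (v ^ α - v ^ (1 - α)) * (u - 1)
          = r * u' * ((v ^ α - v ^ (1 - α)) * (u - 1)) := by ring
        _ ≤ r * u' * ((u ^ α - u ^ (1 - α)) * (v - 1)) := this
        _ = (u ^ α - u ^ (1 - α)) * (r * u' * (v - 1)) := by ring
        _ = _ := by rw [hru]
    rw [e1, e2]
    linarith

/-! ### The numerical budget of one round -/

theorem exp_nine_fifths_le : Real.exp (9 / 5) ≤ 6.058 := by
  have h : Real.exp (9 / 5) ^ 5 ≤ (6.058 : ℝ) ^ 5 := by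
    rw [← Real.exp_nat_mul, show ((5 : ℕ) : ℝ) * (9 / 5) = ((9 : ℕ) : ℝ) * 1 by norm_num,
      Real.exp_nat_mul]
    exact (pow_le_pow_left₀ (Real.exp_pos _).le Real.exp_one_lt_d9.le 9).trans (by norm_num)
  exact le_of_pow_le_pow_left₀ (by norm_num) (by norm_num) h

theorem exp_one_fifth_le : Real.exp (1 / 5) ≤ 1.2215 := by
  have h : Real.exp (1 / 5) ^ 5 ≤ (1.2215 : ℝ) ^ 5 := by
    rw [← Real.exp_nat_mul, show ((5 : ℕ) : ℝ) * (1 / 5) = 1 by norm_num]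
    exact Real.exp_one_lt_d9.le.trans (by norm_num)
  exact le_of_pow_le_pow_left₀ (by norm_num) (by norm_num) h

/-- Chord bound of the exponential on `[0, 9 / 5]`. -/
theorem exp_sub_one_le {x : ℝ} (h0 : 0 ≤ x) (h1 : x ≤ 9 / 5) : Real.exp x - 1 ≤ 2.81 * x := by
  have := convexOn_exp.2 (Set.mem_univ 0) (Set.mem_univ (9 / 5 : ℝ))
    (show 0 ≤ 1 - x / (9 / 5) by rw [sub_nonneg, div_le_one (by norm_num)]; exact h1)
    (show 0 ≤ x / (9 / 5) by positivity) (by ring)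
  simp only [smul_eq_mul, mul_zero, zero_add, Real.exp_zero, mul_one] at this
  rw [div_mul_cancel₀ _ (by norm_num : (9 / 5 : ℝ) ≠ 0)] at this
  have h2 := mul_le_mul_of_nonneg_left exp_nine_fifths_le (show 0 ≤ x / (9 / 5) by positivity)
  linarith

/-- The conditions on the sampling ratio `τ`, the order `α` and `x = 𝓛² / ν²`, solved for `τ`. -/
structure SubsamplingRegime (τ α x : ℝ) : Prop where
  x_pos : 0 < x
  x_le : x ≤ 9 / 5
  one_lt : 1 < α
  τ_pos : 0 < τ
  τ_le : τ ≤ x / (1 + x) / α * Real.exp (-(3 * (α - 1) * x / 2))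

namespace SubsamplingRegime

variable {τ α x : ℝ} (h : SubsamplingRegime τ α x)
include h

theorem τ_le_ratio : τ ≤ x / (1 + x) := by
  have hx := h.x_pos
  have hα := h.one_lt
  have h1 : Real.exp (-(3 * (α - 1) * x / 2)) ≤ 1 :=
    Real.exp_le_one_iff.2 (by have := mul_pos (sub_pos.2 hα) hx; linarith)
  have h2 : x / (1 + x) / α ≤ x / (1 + x) := div_le_self (by positivity) hα.le
  calc τ ≤ _ := h.τ_le
    _ ≤ x / (1 + x) / α * 1 := by gcongr
    _ ≤ x / (1 + x) := by rwa [mul_one]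

theorem τ_lt_one : τ < 1 :=
  h.τ_le_ratio.trans_lt ((div_lt_one (by have := h.x_pos; linarith)).2 (by linarith))

theorem mixture_pos {r : ℝ} (hr : 0 < r) : 0 < 1 + τ * (r - 1) := by
  have := h.τ_lt_one
  have := mul_pos h.τ_pos hr
  linarith

end SubsamplingRegime

/-- Domination of the second-order remainder of the moment of order `α` of the mixture ratio
`1 + τ (r - 1)` by powers of `r` whose Gaussian moments fit into the budget `4 x`. -/
def RemainderDominated (τ α x : ℝ) : Prop :=
  ∃ A B p : ℝ, 0 ≤ A ∧ 0 ≤ B ∧ 0 ≤ p * (p - 1) ∧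
    (∀ r : ℝ, 0 < r →
      (r - 1) ^ 2 * max 1 ((1 + τ * (r - 1)) ^ (α - 2)) ≤ A * (r - 1) ^ 2 + B * r ^ p) ∧
    A * (Real.exp x - 1) + B * Real.exp (p * (p - 1) * x / 2) ≤ 4 * x

namespace SubsamplingRegime

variable {τ α x : ℝ} (h : SubsamplingRegime τ α x)
include h

theorem max_rpow_of_one_le {r : ℝ} (h1 : 1 ≤ r) (hα : α ≤ 2) :
    max 1 ((1 + τ * (r - 1)) ^ (α - 2)) = 1 := by
  have := mul_nonneg h.τ_pos.le (sub_nonneg.2 h1)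
  exact max_eq_left (Real.rpow_le_one_of_one_le_of_nonpos (by linarith) (by linarith))

theorem max_rpow_of_le_one {r : ℝ} (h0 : 0 < r) (h1 : r ≤ 1) (hα : 2 ≤ α) :
    max 1 ((1 + τ * (r - 1)) ^ (α - 2)) = 1 := by
  have := mul_nonneg h.τ_pos.le (sub_nonneg.2 h1)
  exact max_eq_left (Real.rpow_le_one (h.mixture_pos h0).le (by linarith) (by linarith))

/-- For orders at most `2` only ratios `r < 1` contribute to the correction, and there
`(1 - τ)⁻¹ ≤ 1 + x`. The total is `e ^ x - 1 + x ≤ 3.81 x`. -/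
theorem dominated_of_le_two (hα : α ≤ 2) : RemainderDominated τ α x := by
  have hx := h.x_pos
  refine ⟨1, x, 0, zero_le_one, hx.le, by simp, fun r hr => ?_, ?_⟩
  · rw [Real.rpow_zero, one_mul, mul_one]
    rcases le_total 1 r with h1 | h1
    · rw [h.max_rpow_of_one_le h1 hα]; linarith
    · have hτ : 0 < 1 - τ := sub_pos.2 h.τ_lt_one
      have hu : 1 - τ ≤ 1 + τ * (r - 1) := by
        have := mul_pos h.τ_pos hr
        linarith
      have hM : max 1 ((1 + τ * (r - 1)) ^ (α - 2)) ≤ 1 + x := by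
        refine max_le (by linarith) ?_
        calc (1 + τ * (r - 1)) ^ (α - 2) ≤ (1 - τ) ^ (α - 2) :=
              Real.rpow_le_rpow_of_nonpos hτ hu (by linarith)
          _ ≤ (1 - τ) ^ (-1 : ℝ) :=
              Real.rpow_le_rpow_of_exponent_ge hτ (by linarith [h.τ_pos]) (by linarith [h.one_lt])
          _ = (1 - τ)⁻¹ := Real.rpow_neg_one _
          _ ≤ 1 + x := by
              rw [inv_le_iff_one_le_mul₀ hτ]
              have := h.τ_le_ratio
              rw [le_div_iff₀ (by linarith)] at this
              linarith
      have hsq : (r - 1) ^ 2 ≤ 1 := by nlinarith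
      nlinarith [mul_le_mul_of_nonneg_left hM (sq_nonneg (r - 1)),
        mul_le_mul_of_nonneg_right hsq hx.le]
  · have := exp_sub_one_le hx.le h.x_le
    simp only [zero_mul, zero_div, Real.exp_zero]
    linarith

/-- For orders between `2` and `3`, Bernoulli's inequality reduces the correction to the third
moment of the ratio. -/
theorem dominated_of_le_three (hα2 : 2 ≤ α) (hα3 : α ≤ 3) : RemainderDominated τ α x := by
  have hx := h.x_pos
  have hβ0 : 0 ≤ α - 2 := by linarith
  refine ⟨1, (α - 2) * τ, 3, zero_le_one, mul_nonneg hβ0 h.τ_pos.le, by norm_num,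
    fun r hr => ?_, ?_⟩
  · have hr3 : r ^ (3 : ℝ) = r ^ 3 := by rw [← Real.rpow_natCast]; norm_num
    rw [one_mul, hr3]
    have hβτ := mul_nonneg hβ0 h.τ_pos.le
    rcases le_total r 1 with h1 | h1
    · rw [h.max_rpow_of_le_one hr h1 hα2]
      have := mul_nonneg hβτ (pow_pos hr 3).le
      linarith
    · have h0 : 0 ≤ τ * (r - 1) := mul_nonneg h.τ_pos.le (by linarith)
      have hM : max 1 ((1 + τ * (r - 1)) ^ (α - 2)) ≤ 1 + (α - 2) * (τ * (r - 1)) :=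
        max_le (by have := mul_nonneg hβ0 h0; linarith)
          (rpow_one_add_le_one_add_mul_self (by linarith) hβ0 (by linarith))
      have hc : (r - 1) ^ 3 ≤ r ^ 3 := pow_le_pow_left₀ (by linarith) (by linarith) 3
      calc _ ≤ (r - 1) ^ 2 * (1 + (α - 2) * (τ * (r - 1))) := by gcongr
        _ = (r - 1) ^ 2 + (α - 2) * τ * (r - 1) ^ 3 := by ring
        _ ≤ _ := by gcongr
  · have h1 := exp_sub_one_le hx.le h.x_le
    have hK : x / (1 + x) / α ≤ x / 2 := by
      rw [div_div, div_le_div_iff₀ (by positivity) (by positivity)]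
      nlinarith [mul_pos hx hx]
    have hτ : τ * Real.exp (3 * x) ≤ x / 2 * Real.exp (2.7 * (3 - α)) := by
      calc τ * Real.exp (3 * x)
          ≤ x / (1 + x) / α * Real.exp (-(3 * (α - 1) * x / 2)) * Real.exp (3 * x) := by
            gcongr; exact h.τ_le
        _ = x / (1 + x) / α * Real.exp (3 / 2 * x * (3 - α)) := by
            rw [mul_assoc, ← Real.exp_add]; ring_nf
        _ ≤ x / 2 * Real.exp (2.7 * (3 - α)) := by
            refine mul_le_mul hK (Real.exp_le_exp.2 ?_) (Real.exp_pos _).le (by linarith)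
            exact mul_le_mul_of_nonneg_right (by linarith [h.x_le]) (by linarith)
    -- `b e^{2.7 (1 - b)} ≤ e^{1.7} / 2.7` for `b = α - 2`, from `t ≤ e^{t - 1}` at `t = 2.7 b`
    have hb : (α - 2) * Real.exp (2.7 * (3 - α)) ≤ 2.3 := by
      have ht := Real.add_one_le_exp (2.7 * (α - 2) - 1)
      have h2 : 2.7 * (α - 2) * Real.exp (2.7 * (3 - α)) ≤ Real.exp 1.7 := by
        calc 2.7 * (α - 2) * Real.exp (2.7 * (3 - α))
            ≤ Real.exp (2.7 * (α - 2) - 1) * Real.exp (2.7 * (3 - α)) := by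
              gcongr; linarith
          _ = Real.exp 1.7 := by rw [← Real.exp_add]; ring_nf
      have h3 : Real.exp 1.7 ≤ Real.exp (9 / 5) := Real.exp_le_exp.2 (by norm_num)
      have h4 := exp_nine_fifths_le
      linarith
    have h5 : (α - 2) * τ * Real.exp (3 * (3 - 1) * x / 2) ≤ x / 2 * 2.3 := by
      calc (α - 2) * τ * Real.exp (3 * (3 - 1) * x / 2)
          = (α - 2) * (τ * Real.exp (3 * x)) := by ring_nf
        _ ≤ (α - 2) * (x / 2 * Real.exp (2.7 * (3 - α))) := by gcongr
        _ = x / 2 * ((α - 2) * Real.exp (2.7 * (3 - α))) := by ring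
        _ ≤ x / 2 * 2.3 := by gcongr
    linarith

omit h in
/-- Convexity of `t ↦ t ^ β` at `1 + y = (1 - p) (1 - p)⁻¹ + p (y / p)` with `p = 1 / (5 β)`. -/
theorem one_add_rpow_le {β y : ℝ} (hβ : 1 ≤ β) (hy : 0 ≤ y) :
    (1 + y) ^ β ≤ Real.exp (1 / 5) + (5 * β) ^ (β - 1) * y ^ β := by
  set p : ℝ := (5 * β)⁻¹ with hp
  have hp0 : 0 < p := by positivity
  have hpβ : p * (5 * β) = 1 := inv_mul_cancel₀ (by positivity)
  have hp1 : p ≤ 1 / 5 := by nlinarith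
  have hq : 0 < 1 - p := by linarith
  have hconv := (convexOn_rpow hβ).2
    (show (1 - p)⁻¹ ∈ Set.Ici (0 : ℝ) from (inv_pos.2 hq).le)
    (show y / p ∈ Set.Ici (0 : ℝ) from div_nonneg hy hp0.le) hq.le hp0.le (by ring)
  simp only [smul_eq_mul] at hconv
  rw [mul_inv_cancel₀ hq.ne', mul_div_cancel₀ y hp0.ne'] at hconv
  refine hconv.trans (add_le_add ?_ (le_of_eq ?_))
  · have e1 : (1 - p) * (1 - p)⁻¹ ^ β = (1 - p)⁻¹ ^ (β - 1) := by
      rw [Real.rpow_sub_one (inv_pos.2 hq).ne', div_inv_eq_mul, mul_comm]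
    have e2 : (1 - p)⁻¹ ≤ Real.exp (p / (1 - p)) := by
      have := Real.add_one_le_exp (p / (1 - p))
      have e : p / (1 - p) + 1 = (1 - p)⁻¹ := by field_simp; ring
      linarith
    rw [e1]
    calc (1 - p)⁻¹ ^ (β - 1) ≤ Real.exp (p / (1 - p)) ^ (β - 1) :=
          Real.rpow_le_rpow (inv_pos.2 hq).le e2 (by linarith)
      _ = Real.exp (p / (1 - p) * (β - 1)) := (Real.exp_mul _ _).symm
      _ ≤ Real.exp (1 / 5) := by
          refine Real.exp_le_exp.2 ?_
          rw [div_mul_eq_mul_div, div_le_iff₀ hq]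
          nlinarith
  · rw [Real.div_rpow hy hp0.le, hp, Real.inv_rpow (by positivity),
      Real.rpow_sub_one (by positivity)]
    field_simp

/-- For orders at least `3`, convexity splits the correction into a multiple of the second moment
and a multiple of the moment of order `α`, which the condition on `τ` makes at most `x / 3`. The
factor `e ^ (1 / 5)` of the former leaves room for this: `1.2215 * 2.81 + 1 / 3 < 4`. -/
theorem dominated_of_three_le (hα : 3 ≤ α) : RemainderDominated τ α x := by
  have hx := h.x_pos
  have hτ0 := h.τ_pos
  set β := α - 2 with hβ
  have hβ1 : 1 ≤ β := by linarith
  refine ⟨Real.exp (1 / 5), (5 * β) ^ (β - 1) * τ ^ β, α, by positivity, by positivity,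
    mul_nonneg (by linarith) (by linarith), fun r hr => ?_, ?_⟩
  · have hBr : 0 ≤ (5 * β) ^ (β - 1) * τ ^ β * r ^ α := by positivity
    have he1 : 1 ≤ Real.exp (1 / 5) := Real.one_le_exp (by norm_num)
    rcases le_total r 1 with h1 | h1
    · rw [h.max_rpow_of_le_one hr h1 (by linarith)]
      nlinarith [mul_le_mul_of_nonneg_right he1 (sq_nonneg (r - 1))]
    · have hr1 : 0 ≤ r - 1 := by linarith
      have h0 : 0 ≤ τ * (r - 1) := mul_nonneg hτ0.le hr1
      have hM : max 1 ((1 + τ * (r - 1)) ^ β) ≤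
          Real.exp (1 / 5) + (5 * β) ^ (β - 1) * (τ * (r - 1)) ^ β := by
        refine max_le ?_ (one_add_rpow_le hβ1 h0)
        have : 0 ≤ (5 * β) ^ (β - 1) * (τ * (r - 1)) ^ β := by positivity
        linarith
      have hc : (r - 1) ^ 2 * (r - 1) ^ β ≤ r ^ α := by
        rw [← Real.rpow_natCast, ← Real.rpow_add_of_nonneg hr1 (by norm_num) (by linarith),
          show ((2 : ℕ) : ℝ) + β = α by rw [hβ]; push_cast; ring]
        exact Real.rpow_le_rpow hr1 (by linarith) (by linarith)
      calc _ ≤ (r - 1) ^ 2 * (Real.exp (1 / 5) + (5 * β) ^ (β - 1) * (τ * (r - 1)) ^ β) := by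
            gcongr
        _ = Real.exp (1 / 5) * (r - 1) ^ 2 +
              (5 * β) ^ (β - 1) * τ ^ β * ((r - 1) ^ 2 * (r - 1) ^ β) := by
            rw [Real.mul_rpow hτ0.le hr1]; ring
        _ ≤ _ := by gcongr
  · have hmain : Real.exp (1 / 5) * (Real.exp x - 1) ≤ 1.2215 * (2.81 * x) :=
      mul_le_mul exp_one_fifth_le (exp_sub_one_le hx.le h.x_le)
        (by have := Real.add_one_le_exp x; linarith) (by norm_num)
    set K := x / (1 + x) with hK
    have hK0 : 0 < K := by positivity
    have hα0 : 0 < α := by linarith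
    have hKx : K / α ≤ x / 3 := by
      rw [hK, div_div, div_le_div_iff₀ (by positivity) (by positivity)]
      nlinarith [mul_pos hx hx]
    have hsmall : 5 * β * (K / α) * Real.exp (-(2 * x)) ≤ 1 := by
      have hβα : 5 * β * (K / α) ≤ 5 * K := by
        rw [← mul_div_assoc, div_le_iff₀ hα0]
        nlinarith
      have h5 : 5 * K ≤ Real.exp (2 * x) := by
        have h1 := Real.quadratic_le_exp_of_nonneg (by linarith : 0 ≤ 2 * x)
        refine le_trans ?_ h1
        rw [hK, ← mul_div_assoc, div_le_iff₀ (by linarith)]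
        nlinarith [sq_nonneg (1 - 2 * x), pow_pos hx 3]
      calc 5 * β * (K / α) * Real.exp (-(2 * x)) ≤ Real.exp (2 * x) * Real.exp (-(2 * x)) := by
            gcongr; linarith
        _ = 1 := by rw [← Real.exp_add]; simp
    have hτβ : τ ^ β ≤ (K / α) ^ β * Real.exp (-(3 * (α - 1) * x / 2) * β) := by
      rw [Real.exp_mul, ← Real.mul_rpow (by positivity) (Real.exp_pos _).le]
      exact Real.rpow_le_rpow hτ0.le h.τ_le (by linarith)
    have htail : (5 * β) ^ (β - 1) * τ ^ β * Real.exp (α * (α - 1) * x / 2) ≤ x / 3 := by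
      calc (5 * β) ^ (β - 1) * τ ^ β * Real.exp (α * (α - 1) * x / 2)
          ≤ (5 * β) ^ (β - 1) * ((K / α) ^ β * Real.exp (-(3 * (α - 1) * x / 2) * β)) *
              Real.exp (α * (α - 1) * x / 2) := by gcongr
        _ = (5 * β) ^ (β - 1) * (K / α) ^ β * Real.exp (-(α - 1) * (β - 1) * x) := by
            have e : -(α - 1) * (β - 1) * x =
                -(3 * (α - 1) * x / 2) * β + α * (α - 1) * x / 2 := by rw [hβ]; ring
            rw [e, Real.exp_add]; ring
        _ ≤ (5 * β) ^ (β - 1) * (K / α) ^ β * Real.exp (-(2 * x) * (β - 1)) := by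
            refine mul_le_mul_of_nonneg_left (Real.exp_le_exp.2 ?_) (by positivity)
            nlinarith [mul_nonneg (mul_nonneg hx.le (sub_nonneg.2 hβ1)) (sub_nonneg.2 hα)]
        _ = (K / α) * (5 * β * (K / α) * Real.exp (-(2 * x))) ^ (β - 1) := by
            have e : (K / α) ^ β = K / α * (K / α) ^ (β - 1) := by
              rw [← Real.rpow_one_add' (by positivity) (by linarith)]; ring_nf
            rw [Real.mul_rpow (by positivity) (Real.exp_pos _).le,
              Real.mul_rpow (x := 5 * β) (by positivity) (by positivity), ← Real.exp_mul, e]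
            ring
        _ ≤ (K / α) * 1 := by
            gcongr
            exact Real.rpow_le_one (by positivity) hsmall (by linarith)
        _ ≤ x / 3 := by rwa [mul_one]
    linarith

theorem dominated : RemainderDominated τ α x := by
  rcases le_total α 2 with h2 | h2
  · exact h.dominated_of_le_two h2
  rcases le_total α 3 with h3 | h3
  · exact h.dominated_of_le_three h2 h3
  · exact h.dominated_of_three_le h3

/-- Moment of order `α` of the mixture ratio `1 + τ (r - 1)`, for a ratio `r` with the moments of
the likelihood ratio of two Gaussians whose squared normalized distance `x'` is at most `x`. -/
theorem lintegral_mixture_rpow_le {Ω : Type*} [MeasurableSpace Ω] (μ : Measure Ω)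
    [IsProbabilityMeasure μ] {r : Ω → ℝ} (hr0 : ∀ ω, 0 < r ω) {x' : ℝ}
    (hx' : x' ≤ x) (hint : ∀ p : ℝ, Integrable (fun ω => r ω ^ p) μ)
    (hmom : ∀ p : ℝ, ∫ ω, r ω ^ p ∂μ = Real.exp (p * (p - 1) * x' / 2)) :
    ∫⁻ ω, ENNReal.ofReal ((1 + τ * (r ω - 1)) ^ α) ∂μ ≤
      ENNReal.ofReal (Real.exp (2 * α * (α - 1) * τ ^ 2 * x)) := by
  obtain ⟨A, B, p, hA, hB, hp, hdom, hbud⟩ := h.dominated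
  have hα := h.one_lt
  have hi1 : Integrable r μ := by simpa using hint 1
  have hi2 : Integrable (fun ω => r ω ^ 2) μ := by simpa using hint 2
  have hm1 : ∫ ω, r ω ∂μ = 1 := by simpa using hmom 1
  have hm2 : ∫ ω, r ω ^ 2 ∂μ = Real.exp x' := by
    have := hmom 2
    rw [show (2 : ℝ) * (2 - 1) * x' / 2 = x' by ring] at this
    simpa using this
  have hisq : Integrable (fun ω => (r ω - 1) ^ 2) μ := by
    have : (fun ω => (r ω - 1) ^ 2) = fun ω => r ω ^ 2 - 2 * r ω + 1 := by ext; ring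
    rw [this]; exact (hi2.sub (hi1.const_mul 2)).add (integrable_const 1)
  have hsq : ∫ ω, (r ω - 1) ^ 2 ∂μ = Real.exp x' - 1 := by
    have : (fun ω => (r ω - 1) ^ 2) = fun ω => r ω ^ 2 - 2 * r ω + 1 := by ext; ring
    have e : ∫ ω, (r ω ^ 2 - 2 * r ω) ∂μ = Real.exp x' - 2 * 1 := by
      rw [integral_sub hi2 (hi1.const_mul 2), integral_const_mul, hm1, hm2]
    rw [this, integral_add (f := fun ω => r ω ^ 2 - 2 * r ω) (hi2.sub (hi1.const_mul 2))
      (integrable_const 1), e]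
    simp; ring
  set c := α * (α - 1) / 2 * τ ^ 2 with hc
  have hc0 : 0 ≤ c := by
    have : 0 ≤ α * (α - 1) := mul_nonneg (by linarith) (by linarith)
    positivity
  let g : Ω → ℝ := fun ω =>
    1 + α * τ * (r ω - 1) + c * (A * (r ω - 1) ^ 2 + B * r ω ^ p)
  have hig1 : Integrable (fun ω => 1 + α * τ * (r ω - 1)) μ :=
    (integrable_const 1).add ((hi1.sub (integrable_const 1)).const_mul _)
  have hig2 : Integrable (fun ω => c * (A * (r ω - 1) ^ 2 + B * r ω ^ p)) μ :=
    ((hisq.const_mul A).add ((hint p).const_mul B)).const_mul c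
  have hle : ∀ ω, (1 + τ * (r ω - 1)) ^ α ≤ g ω := by
    intro ω
    have h1 := rpow_le_quadratic hα.le (h.mixture_pos (hr0 ω))
    have h2 := mul_le_mul_of_nonneg_left (hdom (r ω) (hr0 ω)) hc0
    simp only [g]
    rw [add_sub_cancel_left] at h1
    calc _ ≤ _ := h1
      _ = 1 + α * τ * (r ω - 1) +
          c * ((r ω - 1) ^ 2 * max 1 ((1 + τ * (r ω - 1)) ^ (α - 2))) := by rw [hc]; ring
      _ ≤ _ := by linarith
  have hg0 : ∀ ω, 0 ≤ g ω := fun ω =>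
    (Real.rpow_nonneg (h.mixture_pos (hr0 ω)).le _).trans (hle ω)
  calc ∫⁻ ω, ENNReal.ofReal ((1 + τ * (r ω - 1)) ^ α) ∂μ
      ≤ ∫⁻ ω, ENNReal.ofReal (g ω) ∂μ :=
        lintegral_mono fun ω => ENNReal.ofReal_le_ofReal (hle ω)
    _ = ENNReal.ofReal (∫ ω, g ω ∂μ) :=
        (ofReal_integral_eq_lintegral_ofReal (hig1.add hig2) (.of_forall hg0)).symm
    _ ≤ _ := by
        refine ENNReal.ofReal_le_ofReal ?_
        have e1 : ∫ ω, (1 + α * τ * (r ω - 1)) ∂μ = 1 := by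
          have e : ∫ ω, (r ω - 1) ∂μ = 0 := by
            rw [integral_sub hi1 (integrable_const 1), hm1]; simp
          rw [integral_add (g := fun ω => α * τ * (r ω - 1)) (integrable_const 1)
            ((hi1.sub (integrable_const 1)).const_mul _), integral_const_mul, e]
          simp
        have e2 : ∫ ω, g ω ∂μ = 1 + c * (A * (Real.exp x' - 1) +
            B * Real.exp (p * (p - 1) * x' / 2)) := by
          simp only [g]
          rw [integral_add hig1 hig2, e1, integral_const_mul,
            integral_add (hisq.const_mul A) ((hint p).const_mul B), integral_const_mul,
            integral_const_mul, hsq, hmom p]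
        rw [e2]
        have e3 : A * (Real.exp x' - 1) + B * Real.exp (p * (p - 1) * x' / 2) ≤ 4 * x := by
          refine le_trans ?_ hbud
          gcongr
        calc 1 + c * (A * (Real.exp x' - 1) + B * Real.exp (p * (p - 1) * x' / 2))
            ≤ 1 + c * (4 * x) := by gcongr
          _ = 2 * α * (α - 1) * τ ^ 2 * x + 1 := by rw [hc]; ring
          _ ≤ _ := Real.add_one_le_exp _

end SubsamplingRegime

/-! ### Translations of the Gaussian noise -/

/-- A product of probability measures with densities has the product density. -/
theorem pi_withDensity {ι : Type*} [Fintype ι] {E : ι → Type*} [∀ i, MeasurableSpace (E i)]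
    (μ : ∀ i, Measure (E i)) [∀ i, IsProbabilityMeasure (μ i)] {f : ∀ i, E i → ENNReal}
    (hf : ∀ i, Measurable (f i)) [∀ i, SigmaFinite ((μ i).withDensity (f i))] :
    Measure.pi (fun i => (μ i).withDensity (f i)) =
      (Measure.pi μ).withDensity fun x => ∏ i, f i (x i) := by
  refine Measure.pi_eq fun s hs => ?_
  have hind : ∀ x, (Set.univ.pi s).indicator (fun x => ∏ i, f i (x i)) x =
      ∏ i, (s i).indicator (f i) (x i) := by
    intro x
    by_cases hx : x ∈ Set.univ.pi s
    · rw [Set.indicator_of_mem hx]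
      exact Finset.prod_congr rfl fun i _ => (Set.indicator_of_mem (hx i trivial) _).symm
    · rw [Set.indicator_of_notMem hx]
      simp only [Set.mem_univ_pi, not_forall] at hx
      obtain ⟨i, hi⟩ := hx
      exact (Finset.prod_eq_zero (Finset.mem_univ i) (Set.indicator_of_notMem hi _)).symm
  have hm : ∀ i, Measurable ((s i).indicator (f i)) := fun i => (hf i).indicator (hs i)
  rw [withDensity_apply _ (.univ_pi hs), ← lintegral_indicator (.univ_pi hs)]
  simp_rw [hind]
  rw [lintegral_prod_eq_prod_lintegral_of_indepFun _
    (fun i (x : ∀ i, E i) => (s i).indicator (f i) (x i))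
    (iIndepFun_pi fun i => (hm i).aemeasurable) fun i => (hm i).comp (measurable_pi_apply i)]
  refine Finset.prod_congr rfl fun i _ => ?_
  rw [withDensity_apply _ (hs i), ← lintegral_indicator (hs i),
    ← (measurePreserving_eval μ i).lintegral_comp (hm i)]

theorem gaussianReal_eq_withDensity (a : ℝ) {v : NNReal} (hv : v ≠ 0) :
    gaussianReal a v = (gaussianReal 0 v).withDensity
      fun y => ENNReal.ofReal (Real.exp ((a * y - a ^ 2 / 2) / v)) := by
  rw [gaussianReal_of_var_ne_zero a hv, gaussianReal_of_var_ne_zero 0 hv,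
    ← withDensity_mul _ (measurable_gaussianPDF 0 v) (by fun_prop)]
  congr 1
  ext y
  have hv' : (v : ℝ) ≠ 0 := by exact_mod_cast hv
  rw [Pi.mul_apply, gaussianPDF, gaussianPDF, ← ENNReal.ofReal_mul (gaussianPDFReal_nonneg _ _ _),
    gaussianPDFReal, gaussianPDFReal, mul_assoc (√(2 * Real.pi * v))⁻¹, ← Real.exp_add]
  congr 3
  field_simp
  ring

/-- The density of `N(Δ, ν² I)` with respect to `N(0, ν² I)`. -/
def likelihoodRatio {d : ℕ} (ν : ℝ) (Δ y : Model d) : ℝ :=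
  Real.exp ((inner ℝ Δ y - ‖Δ‖ ^ 2 / 2) / ν ^ 2)

theorem likelihoodRatio_pos {d : ℕ} (ν : ℝ) (Δ y : Model d) : 0 < likelihoodRatio ν Δ y :=
  Real.exp_pos _

theorem measurable_likelihoodRatio_right {d : ℕ} (ν : ℝ) (Δ : Model d) :
    Measurable (likelihoodRatio ν Δ) := by
  unfold likelihoodRatio
  fun_prop

theorem map_add_gaussianNoise {d : ℕ} {ν : ℝ} (hν : ν ≠ 0) (Δ : Model d) :
    (gaussianNoise d ν).map (fun y => Δ + y) =
      (gaussianNoise d ν).withDensity fun y => ENNReal.ofReal (likelihoodRatio ν Δ y) := by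
  have hv : Real.toNNReal (ν ^ 2) ≠ 0 := (Real.toNNReal_pos.2 (by positivity)).ne'
  have hvc : ((Real.toNNReal (ν ^ 2) : NNReal) : ℝ) = ν ^ 2 := Real.coe_toNNReal _ (sq_nonneg ν)
  set v := Real.toNNReal (ν ^ 2) with hvdef
  have hshift : (Measure.pi fun _ : Fin d => gaussianReal 0 v).map (fun x i => Δ i + x i) =
      (Measure.pi fun _ : Fin d => gaussianReal 0 v).withDensity fun x =>
        ∏ i, ENNReal.ofReal (Real.exp ((Δ i * x i - Δ i ^ 2 / 2) / v)) := by
    have h1 : ∀ i, IsProbabilityMeasure ((gaussianReal 0 v).withDensity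
        fun y => ENNReal.ofReal (Real.exp ((Δ i * y - Δ i ^ 2 / 2) / v))) := fun i => by
      rw [← gaussianReal_eq_withDensity _ hv]; infer_instance
    rw [← pi_withDensity (fun _ : Fin d => gaussianReal 0 v)
      (f := fun i y => ENNReal.ofReal (Real.exp ((Δ i * y - Δ i ^ 2 / 2) / v)))
      (fun i => by fun_prop)]
    simp_rw [← gaussianReal_eq_withDensity _ hv]
    have h2 : ∀ i, IsProbabilityMeasure ((gaussianReal 0 v).map fun y => Δ i + y) := fun i =>
      Measure.isProbabilityMeasure_map (by fun_prop)
    rw [Measure.pi_map_pi (f := fun i y => Δ i + y) fun i => by fun_prop]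
    simp_rw [gaussianReal_map_const_add, zero_add]
  have hm : Measurable (WithLp.toLp 2 : (Fin d → ℝ) → Model d) := by fun_prop
  have hdens : Measurable fun y : Model d => ENNReal.ofReal (likelihoodRatio ν Δ y) :=
    (measurable_likelihoodRatio_right ν Δ).ennreal_ofReal
  have hratio : ∀ x : Fin d → ℝ, ENNReal.ofReal (likelihoodRatio ν Δ (WithLp.toLp 2 x)) =
      ∏ i, ENNReal.ofReal (Real.exp ((Δ i * x i - Δ i ^ 2 / 2) / v)) := by
    intro x
    rw [← ENNReal.ofReal_prod_of_nonneg fun i _ => (Real.exp_pos _).le, ← Real.exp_sum, hvc,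
      ← Finset.sum_div, Finset.sum_sub_distrib, ← Finset.sum_div, likelihoodRatio,
      EuclideanSpace.real_norm_sq_eq, PiLp.inner_apply]
    simp [mul_comm]
  refine Measure.ext_of_lintegral _ fun f hf => ?_
  have hfd : Measurable fun x : Fin d → ℝ => f (Δ + WithLp.toLp 2 x) := by fun_prop
  have hfm : Measurable fun x : Fin d → ℝ => f (WithLp.toLp 2 x) := by fun_prop
  rw [lintegral_map hf (by fun_prop), lintegral_withDensity_eq_lintegral_mul _ hdens hf,
    gaussianNoise, lintegral_map (by fun_prop) hm, lintegral_map (hdens.mul hf) hm]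
  have h3 := lintegral_map (μ := Measure.pi fun _ : Fin d => gaussianReal 0 v) hfm
    (show Measurable fun x : Fin d → ℝ => fun i => Δ i + x i by fun_prop)
  rw [hshift, lintegral_withDensity_eq_lintegral_mul _ (by fun_prop) hfm] at h3
  simp only [Pi.mul_apply, hratio] at h3 ⊢
  rw [h3]
  rfl

theorem map_neg_gaussianNoise (d : ℕ) (ν : ℝ) :
    (gaussianNoise d ν).map (fun y => -y) = gaussianNoise d ν := by
  set v := Real.toNNReal (ν ^ 2) with hvdef
  have h2 : IsProbabilityMeasure ((gaussianReal 0 v).map fun y => -y) :=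
      Measure.isProbabilityMeasure_map (by fun_prop)
  have h : (Measure.pi fun _ : Fin d => gaussianReal 0 v).map (fun x i => -x i) =
      Measure.pi fun _ : Fin d => gaussianReal 0 v := by
    rw [Measure.pi_map_pi (f := fun _ y => -y) fun i => by fun_prop]
    simp_rw [gaussianReal_map_neg, neg_zero]
  have hm : Measurable (WithLp.toLp 2 : (Fin d → ℝ) → Model d) := by fun_prop
  conv_rhs => rw [gaussianNoise, ← hvdef, ← h]
  rw [gaussianNoise, Measure.map_map (by fun_prop) hm, Measure.map_map hm (by fun_prop)]
  rfl

/-! ### Moments of the Gaussian likelihood ratio -/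

theorem integrable_exp_inner_gaussianNoise {d : ℕ} (ν : ℝ) (v : Model d) :
    Integrable (fun y => Real.exp (inner ℝ v y)) (gaussianNoise d ν) := by
  have hm : Measurable (WithLp.toLp 2 : (Fin d → ℝ) → Model d) := by fun_prop
  rw [gaussianNoise, integrable_map_measure (by fun_prop) hm.aemeasurable]
  have e : ((fun y => Real.exp (inner ℝ v y)) ∘ (WithLp.toLp 2 : (Fin d → ℝ) → Model d)) =
      fun x => ∏ i, Real.exp (v i * x i) := by
    ext x
    rw [← Real.exp_sum]
    simp [PiLp.inner_apply, mul_comm]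
  rw [e]
  exact Integrable.fintype_prod_dep fun i => integrable_exp_mul_gaussianReal (v i)

theorem integral_exp_inner_gaussianNoise {d : ℕ} (ν : ℝ) (v : Model d) :
    ∫ y, Real.exp (inner ℝ v y) ∂gaussianNoise d ν = Real.exp (ν ^ 2 * ‖v‖ ^ 2 / 2) := by
  have hm : Measurable (WithLp.toLp 2 : (Fin d → ℝ) → Model d) := by fun_prop
  rw [gaussianNoise, integral_map hm.aemeasurable (by fun_prop)]
  have e : ∀ x : Fin d → ℝ, Real.exp (inner ℝ v (WithLp.toLp 2 x : Model d)) =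
      ∏ i, Real.exp (v i * x i) := by
    intro x
    rw [← Real.exp_sum]
    simp [PiLp.inner_apply, mul_comm]
  simp_rw [e]
  rw [integral_fintype_prod_eq_prod (f := fun i y => Real.exp (v i * y))]
  have h1 : ∀ i, ∫ y, Real.exp (v i * y) ∂gaussianReal 0 (Real.toNNReal (ν ^ 2)) =
      Real.exp (ν ^ 2 * v i ^ 2 / 2) := by
    intro i
    have := congrFun (mgf_id_gaussianReal (μ := 0) (v := Real.toNNReal (ν ^ 2))) (v i)
    rw [Real.coe_toNNReal _ (sq_nonneg ν), zero_mul, zero_add] at this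
    exact this
  simp_rw [h1]
  rw [← Real.exp_sum, EuclideanSpace.real_norm_sq_eq, ← Finset.sum_div, Finset.mul_sum]

theorem likelihoodRatio_rpow {d : ℕ} (ν : ℝ) (Δ y : Model d) (p : ℝ) :
    likelihoodRatio ν Δ y ^ p =
      Real.exp (-(p * ‖Δ‖ ^ 2 / (2 * ν ^ 2))) * Real.exp (inner ℝ ((p / ν ^ 2) • Δ) y) := by
  rw [likelihoodRatio, ← Real.exp_mul, ← Real.exp_add, real_inner_smul_left]
  ring_nf

theorem integrable_likelihoodRatio_rpow {d : ℕ} (ν : ℝ) (Δ : Model d) (p : ℝ) :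
    Integrable (fun y => likelihoodRatio ν Δ y ^ p) (gaussianNoise d ν) := by
  simp_rw [likelihoodRatio_rpow]
  exact (integrable_exp_inner_gaussianNoise ν _).const_mul _

theorem integral_likelihoodRatio_rpow {d : ℕ} {ν : ℝ} (hν : ν ≠ 0) (Δ : Model d) (p : ℝ) :
    ∫ y, likelihoodRatio ν Δ y ^ p ∂gaussianNoise d ν =
      Real.exp (p * (p - 1) * (‖Δ‖ ^ 2 / ν ^ 2) / 2) := by
  simp_rw [likelihoodRatio_rpow]
  rw [integral_const_mul, integral_exp_inner_gaussianNoise, ← Real.exp_add, norm_smul, mul_pow,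
    Real.norm_eq_abs, sq_abs]
  congr 1
  field_simp
  ring

/-- The reflection `y ↦ Δ - y` exchanges `N(0, ν² I)` and `N(Δ, ν² I)` and inverts their
likelihood ratio. -/
theorem lintegral_comp_likelihoodRatio {d : ℕ} {ν : ℝ} (hν : ν ≠ 0) (Δ : Model d)
    {g : ℝ → ENNReal} (hg : Measurable g) :
    ∫⁻ y, g (likelihoodRatio ν Δ y) ∂gaussianNoise d ν =
      ∫⁻ y, ENNReal.ofReal (likelihoodRatio ν Δ y) * g (likelihoodRatio ν Δ y)⁻¹
        ∂gaussianNoise d ν := by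
  have hr := measurable_likelihoodRatio_right ν Δ
  have hg' : Measurable fun y => g (likelihoodRatio ν Δ y)⁻¹ := hg.comp hr.inv
  have h2 : Measurable fun y : Model d => g (likelihoodRatio ν Δ (Δ + y))⁻¹ :=
    hg'.comp (measurable_const_add Δ)
  calc ∫⁻ y, g (likelihoodRatio ν Δ y) ∂gaussianNoise d ν
      = ∫⁻ y, g (likelihoodRatio ν Δ (Δ + -y))⁻¹ ∂gaussianNoise d ν := by
        refine lintegral_congr fun y => congrArg g ?_
        rw [likelihoodRatio, likelihoodRatio, ← Real.exp_neg, inner_add_right, inner_neg_right,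
          real_inner_self_eq_norm_sq]
        congr 1
        ring
    _ = ∫⁻ y, g (likelihoodRatio ν Δ (Δ + y))⁻¹ ∂(gaussianNoise d ν).map fun y => -y :=
        (lintegral_map h2 measurable_neg).symm
    _ = ∫⁻ y, g (likelihoodRatio ν Δ y)⁻¹ ∂(gaussianNoise d ν).map fun y => Δ + y := by
        rw [map_neg_gaussianNoise, lintegral_map hg' (measurable_const_add Δ)]
    _ = _ := by
        rw [map_add_gaussianNoise hν,
          lintegral_withDensity_eq_lintegral_mul _ hr.ennreal_ofReal hg']
        rfl

/-! ### One round of the subsampled Gaussian mechanism -/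

/-- The log-likelihood ratio of the mixture `(1 - τ) N(0, ν² I) + τ N(Δ, ν² I)` with respect to
`N(0, ν² I)`. -/
def mixtureLogRatio {d : ℕ} (τ ν : ℝ) (Δ y : Model d) : ℝ :=
  Real.log (1 + τ * (likelihoodRatio ν Δ y - 1))

@[fun_prop]
theorem measurable_mixtureLogRatio {d : ℕ} (τ ν : ℝ) {Z : Type*} [MeasurableSpace Z]
    {Δ y : Z → Model d} (hΔ : Measurable Δ) (hy : Measurable y) :
    Measurable fun z => mixtureLogRatio τ ν (Δ z) (y z) := by
  unfold mixtureLogRatio likelihoodRatio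
  fun_prop

namespace SubsamplingRegime

variable {τ α x : ℝ} (h : SubsamplingRegime τ α x)
include h

theorem exp_mul_mixtureLogRatio {d : ℕ} (ν : ℝ) (Δ y : Model d) (p : ℝ) :
    Real.exp (p * mixtureLogRatio τ ν Δ y) = (1 + τ * (likelihoodRatio ν Δ y - 1)) ^ p := by
  rw [mixtureLogRatio, Real.rpow_def_of_pos (h.mixture_pos (likelihoodRatio_pos _ _ _)), mul_comm]

/-- The likelihood ratio of the subsampled mechanism with respect to the one without the
additional client has small moment of order `α`. -/
theorem lintegral_exp_mixtureLogRatio_le {d : ℕ} {ν : ℝ} (hν : ν ≠ 0) {Δ : Model d}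
    (hΔ : ‖Δ‖ ^ 2 / ν ^ 2 ≤ x) :
    ∫⁻ y, ENNReal.ofReal (Real.exp (α * mixtureLogRatio τ ν Δ y)) ∂gaussianNoise d ν ≤
      ENNReal.ofReal (Real.exp (2 * α * (α - 1) * τ ^ 2 * x)) := by
  simp_rw [h.exp_mul_mixtureLogRatio]
  exact h.lintegral_mixture_rpow_le _ (likelihoodRatio_pos ν Δ) hΔ
    (integrable_likelihoodRatio_rpow ν Δ) (integral_likelihoodRatio_rpow hν Δ)

/-- The moment of order `1 - α`, which governs the opposite direction of privacy, is at most the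
moment of order `α`. -/
theorem lintegral_exp_mixtureLogRatio_le' {d : ℕ} {ν : ℝ} (hν : ν ≠ 0) {Δ : Model d}
    (hΔ : ‖Δ‖ ^ 2 / ν ^ 2 ≤ x) :
    ∫⁻ y, ENNReal.ofReal (Real.exp ((1 - α) * mixtureLogRatio τ ν Δ y)) ∂gaussianNoise d ν ≤
      ENNReal.ofReal (Real.exp (2 * α * (α - 1) * τ ^ 2 * x)) := by
  refine le_trans ?_ (h.lintegral_exp_mixtureLogRatio_le hν hΔ)
  simp_rw [h.exp_mul_mixtureLogRatio]
  let g : ℝ → ℝ → ENNReal := fun p r => ENNReal.ofReal ((1 + τ * (r - 1)) ^ p)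
  have hgm : ∀ p, Measurable (g p) := fun p => by
    have : Measurable fun r : ℝ => (1 + τ * (r - 1)) ^ p := by fun_prop
    exact this.ennreal_ofReal
  have hr := measurable_likelihoodRatio_right ν Δ
  -- twice the moment of order `p`, symmetrized by the reflection
  have hsym : ∀ p, 2 * ∫⁻ y, g p (likelihoodRatio ν Δ y) ∂gaussianNoise d ν =
      ∫⁻ y, (g p (likelihoodRatio ν Δ y) + ENNReal.ofReal (likelihoodRatio ν Δ y) *
        g p (likelihoodRatio ν Δ y)⁻¹) ∂gaussianNoise d ν := by
    intro p
    rw [lintegral_add_left (f := fun y => g p (likelihoodRatio ν Δ y)) ((hgm p).comp hr),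
      ← lintegral_comp_likelihoodRatio hν Δ (hgm p),
      two_mul]
  have key : 2 * ∫⁻ y, g (1 - α) (likelihoodRatio ν Δ y) ∂gaussianNoise d ν ≤
      2 * ∫⁻ y, g α (likelihoodRatio ν Δ y) ∂gaussianNoise d ν := by
    rw [hsym, hsym]
    refine lintegral_mono fun y => ?_
    have hr0 := likelihoodRatio_pos ν Δ y
    have hu := h.mixture_pos hr0
    have hu' := h.mixture_pos (inv_pos.2 hr0)
    have := reflected_rpow_le h.one_lt.le h.τ_pos.le h.τ_lt_one hr0
    simp only [show ∀ r, 1 - τ + τ * r = 1 + τ * (r - 1) from fun r => by ring] at this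
    simp only [g]
    rw [← ENNReal.ofReal_mul hr0.le, ← ENNReal.ofReal_mul hr0.le,
      ← ENNReal.ofReal_add (Real.rpow_nonneg hu.le _)
        (mul_nonneg hr0.le (Real.rpow_nonneg hu'.le _)),
      ← ENNReal.ofReal_add (Real.rpow_nonneg hu.le _)
        (mul_nonneg hr0.le (Real.rpow_nonneg hu'.le _))]
    exact ENNReal.ofReal_le_ofReal this
  exact (ENNReal.mul_le_mul_iff_right (by norm_num) (by norm_num)).1 key

end SubsamplingRegime

/-! ### Privacy loss -/

/-- `P` and `Q` are the laws of one statistic under two laws of a larger experiment whose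
log-likelihood ratio `l` (the privacy loss) satisfies `E_Q[e^{α l}] ≤ c` and
`E_Q[e^{(1 - α) l}] ≤ c`. The experiment is recorded by the joint law `Θ` under `Q` of the privacy
loss and the statistic. -/
def PrivacyLossBound {E : Type*} [MeasurableSpace E] (α : ℝ) (c : ENNReal) (P Q : Measure E) :
    Prop :=
  ∃ Θ : Measure (ℝ × E), IsProbabilityMeasure Θ ∧ Θ.map Prod.snd = Q ∧
    (Θ.withDensity fun z => ENNReal.ofReal (Real.exp z.1)).map Prod.snd = P ∧
    ∫⁻ z, ENNReal.ofReal (Real.exp (α * z.1)) ∂Θ ≤ c ∧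
    ∫⁻ z, ENNReal.ofReal (Real.exp ((1 - α) * z.1)) ∂Θ ≤ c

theorem lintegral_map_snd_withDensity_exp {E : Type*} [MeasurableSpace E] (Θ : Measure (ℝ × E))
    {f : E → ENNReal} (hf : Measurable f) :
    ∫⁻ s, f s ∂(Θ.withDensity fun z => ENNReal.ofReal (Real.exp z.1)).map Prod.snd =
      ∫⁻ z, ENNReal.ofReal (Real.exp z.1) * f z.2 ∂Θ := by
  rw [lintegral_map hf measurable_snd,
    lintegral_withDensity_eq_lintegral_mul _ (by fun_prop)
      (show Measurable fun z : ℝ × E => f z.2 by fun_prop)]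
  rfl

theorem PrivacyLossBound.dirac {E : Type*} [MeasurableSpace E] (α : ℝ) (s : E) :
    PrivacyLossBound α 1 (Measure.dirac s) (Measure.dirac s) := by
  refine ⟨Measure.dirac (0, s), inferInstance, ?_, ?_, ?_, ?_⟩
  · rw [Measure.map_dirac' measurable_snd]
  · refine Measure.ext_of_lintegral _ fun f hf => ?_
    rw [lintegral_map_snd_withDensity_exp _ hf, lintegral_dirac' _ (by fun_prop),
      lintegral_dirac' _ hf]
    simp
  · rw [lintegral_dirac' _ (by fun_prop)]; simp
  · rw [lintegral_dirac' _ (by fun_prop)]; simp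

/-- Adaptive composition: privacy losses add up along a step whose conditional log-likelihood
ratio `ℓ (s, ·)` has moments at most `c'` for every current state `s`. -/
theorem PrivacyLossBound.step {E E' Z : Type*} [MeasurableSpace E] [MeasurableSpace E']
    [MeasurableSpace Z] {α : ℝ} {c c' : ENNReal} {P Q : Measure E} (h : PrivacyLossBound α c P Q)
    (m : Measure Z) [IsProbabilityMeasure m] {F : E × Z → E'} (hF : Measurable F) {ℓ : E × Z → ℝ}
    (hℓ : Measurable ℓ)
    (h1 : ∀ s, ∫⁻ z, ENNReal.ofReal (Real.exp (α * ℓ (s, z))) ∂m ≤ c')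
    (h2 : ∀ s, ∫⁻ z, ENNReal.ofReal (Real.exp ((1 - α) * ℓ (s, z))) ∂m ≤ c') {P' Q' : Measure E'}
    (hQ' : ∀ f : E' → ENNReal, Measurable f → ∫⁻ s, f s ∂Q' = ∫⁻ s, ∫⁻ z, f (F (s, z)) ∂m ∂Q)
    (hP' : ∀ f : E' → ENNReal, Measurable f → ∫⁻ s, f s ∂P' =
      ∫⁻ s, ∫⁻ z, ENNReal.ofReal (Real.exp (ℓ (s, z))) * f (F (s, z)) ∂m ∂P) :
    PrivacyLossBound α (c * c') P' Q' := by
  obtain ⟨Θ, hΘ, rfl, rfl, hc1, hc2⟩ := h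
  let G : (ℝ × E) × Z → ℝ × E' := fun q => (q.1.1 + ℓ (q.1.2, q.2), F (q.1.2, q.2))
  have hG : Measurable G := by fun_prop
  have hmom : ∀ p : ℝ, ∫⁻ z, ENNReal.ofReal (Real.exp (p * z.1)) ∂Θ ≤ c →
      (∀ s, ∫⁻ z, ENNReal.ofReal (Real.exp (p * ℓ (s, z))) ∂m ≤ c') →
      ∫⁻ z, ENNReal.ofReal (Real.exp (p * z.1)) ∂(Θ.prod m).map G ≤ c * c' := by
    intro p hp hp'
    rw [lintegral_map (by fun_prop) hG, lintegral_prod _ (by fun_prop)]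
    calc ∫⁻ q, ∫⁻ z, ENNReal.ofReal (Real.exp (p * (G (q, z)).1)) ∂m ∂Θ
        = ∫⁻ q, ENNReal.ofReal (Real.exp (p * q.1)) *
            ∫⁻ z, ENNReal.ofReal (Real.exp (p * ℓ (q.2, z))) ∂m ∂Θ := by
          refine lintegral_congr fun q => ?_
          rw [← lintegral_const_mul _ (by fun_prop)]
          refine lintegral_congr fun z => ?_
          rw [← ENNReal.ofReal_mul (Real.exp_pos _).le, ← Real.exp_add, ← mul_add]
      _ ≤ ∫⁻ q, ENNReal.ofReal (Real.exp (p * q.1)) * c' ∂Θ :=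
          lintegral_mono fun q => mul_le_mul_right (hp' q.2) _
      _ = (∫⁻ q, ENNReal.ofReal (Real.exp (p * q.1)) ∂Θ) * c' :=
          lintegral_mul_const _ (by fun_prop)
      _ ≤ c * c' := mul_le_mul_left hp _
  refine ⟨(Θ.prod m).map G, Measure.isProbabilityMeasure_map hG.aemeasurable, ?_, ?_,
    hmom α hc1 h1, hmom (1 - α) hc2 h2⟩
  · refine Measure.ext_of_lintegral _ fun f hf => ?_
    rw [hQ' f hf, lintegral_map hf measurable_snd, lintegral_map (by fun_prop) hG,
      lintegral_prod _ (by fun_prop)]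
    have hm : Measurable fun s => ∫⁻ z, f (F (s, z)) ∂m :=
      Measurable.lintegral_prod_right' (f := fun q => f (F q)) (by fun_prop)
    rw [lintegral_map hm measurable_snd]
  · refine Measure.ext_of_lintegral _ fun f hf => ?_
    have hm : Measurable fun s => ∫⁻ z, ENNReal.ofReal (Real.exp (ℓ (s, z))) * f (F (s, z)) ∂m :=
      Measurable.lintegral_prod_right'
        (f := fun q => ENNReal.ofReal (Real.exp (ℓ q)) * f (F q)) (by fun_prop)
    rw [hP' f hf, lintegral_map_snd_withDensity_exp _ hf, lintegral_map_snd_withDensity_exp _ hm,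
      lintegral_map (by fun_prop) hG, lintegral_prod _ (by fun_prop)]
    refine lintegral_congr fun q => ?_
    rw [← lintegral_const_mul _ (by fun_prop)]
    refine lintegral_congr fun z => ?_
    rw [← mul_assoc, ← ENNReal.ofReal_mul (Real.exp_pos _).le, ← Real.exp_add]

/-- Integrating a pointwise bound `v ≤ k w + K u` over an event. -/
theorem setLIntegral_le_of_le {X : Type*} [MeasurableSpace X] (Θ : Measure X) (S : Set X)
    {u v w : X → ENNReal} (hu : Measurable u) (hw : Measurable w) (k K : ENNReal)
    (h : ∀ z, v z ≤ k * w z + K * u z) :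
    ∫⁻ z in S, v z ∂Θ ≤ k * ∫⁻ z in S, w z ∂Θ + K * ∫⁻ z, u z ∂Θ := by
  calc ∫⁻ z in S, v z ∂Θ ≤ ∫⁻ z in S, (k * w z + K * u z) ∂Θ := lintegral_mono h
    _ = k * ∫⁻ z in S, w z ∂Θ + K * ∫⁻ z in S, u z ∂Θ := by
        rw [lintegral_add_left (hw.const_mul k), lintegral_const_mul _ hw,
          lintegral_const_mul _ hu]
    _ ≤ _ := by gcongr; exact Measure.restrict_le_self

/-- Markov's inequality for the privacy loss turns its moments into differential privacy, in both
directions. -/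
theorem PrivacyLossBound.le {E : Type*} [MeasurableSpace E] {α : ℝ} {c : ENNReal}
    {P Q : Measure E} (h : PrivacyLossBound α c P Q) (hα : 1 ≤ α) (ε : ℝ) {O : Set E}
    (hO : MeasurableSet O) :
    P O ≤ ENNReal.ofReal (Real.exp ε) * Q O +
        ENNReal.ofReal (Real.exp (-((α - 1) * ε))) * c ∧
      Q O ≤ ENNReal.ofReal (Real.exp ε) * P O +
        ENNReal.ofReal (Real.exp (-((α - 1) * ε))) * c := by
  obtain ⟨Θ, hΘ, rfl, rfl, hc1, hc2⟩ := h
  have hS : MeasurableSet (Prod.snd ⁻¹' O : Set (ℝ × E)) := measurable_snd hO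
  rw [Measure.map_apply measurable_snd hO, Measure.map_apply measurable_snd hO,
    withDensity_apply _ hS, ← setLIntegral_one (Prod.snd ⁻¹' O)]
  constructor
  · refine (setLIntegral_le_of_le Θ _
      (u := fun z => ENNReal.ofReal (Real.exp (α * z.1))) (w := fun _ => 1)
      (by fun_prop) (by fun_prop) _ _ fun z => ?_).trans
      (add_le_add_right (mul_le_mul_right hc1 _) _)
    rw [mul_one, ← ENNReal.ofReal_mul (Real.exp_pos _).le, ← Real.exp_add,
      ← ENNReal.ofReal_add (Real.exp_pos _).le (Real.exp_pos _).le]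
    refine ENNReal.ofReal_le_ofReal ?_
    rcases le_total z.1 ε with hz | hz
    · exact (Real.exp_le_exp.2 hz).trans (le_add_of_nonneg_right (Real.exp_pos _).le)
    · refine (Real.exp_le_exp.2 ?_).trans (le_add_of_nonneg_left (Real.exp_pos _).le)
      nlinarith [mul_le_mul_of_nonneg_left hz (sub_nonneg.2 hα)]
  · refine (setLIntegral_le_of_le Θ _
      (u := fun z => ENNReal.ofReal (Real.exp ((1 - α) * z.1)))
      (w := fun z => ENNReal.ofReal (Real.exp z.1))
      (by fun_prop) (by fun_prop) _ _ fun z => ?_).trans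
      (add_le_add_right (mul_le_mul_right hc2 _) _)
    rw [← ENNReal.ofReal_mul (Real.exp_pos _).le, ← ENNReal.ofReal_mul (Real.exp_pos _).le,
      ← Real.exp_add, ← Real.exp_add,
      ← ENNReal.ofReal_add (Real.exp_pos _).le (Real.exp_pos _).le, ENNReal.one_le_ofReal]
    rcases le_total (-ε) z.1 with hz | hz
    · exact (Real.one_le_exp (by linarith)).trans (le_add_of_nonneg_right (Real.exp_pos _).le)
    · refine (Real.one_le_exp ?_).trans (le_add_of_nonneg_left (Real.exp_pos _).le)
      nlinarith [mul_le_mul_of_nonneg_left hz (sub_nonneg.2 hα)]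

/-! ### The training procedure as a Markov chain -/

variable {d : ℕ} {Ξ : Type*} [MeasurableSpace Ξ] {C : Type*}

/-- The contribution of a client to the aggregate, given whether it is active and its
mini-batches. -/
def contribution (P : Params d) (c : Client d Ξ) (w : Model d) (q : Bool × Ξ) : Model d :=
  if q.1 = true then clientUpdate P c w q.2 else 0

@[fun_prop]
theorem measurable_clientUpdate (P : Params d) (c : Client d Ξ) {Z : Type*} [MeasurableSpace Z]
    {w : Z → Model d} {ξ : Z → Ξ} (hw : Measurable w) (hξ : Measurable ξ) :
    Measurable fun z => clientUpdate P c (w z) (ξ z) :=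
  ((measurable_localModel P c P.localSteps).comp (hw.prodMk hξ)).sub hw

@[fun_prop]
theorem measurable_contribution (P : Params d) (c : Client d Ξ) {Z : Type*} [MeasurableSpace Z]
    {w : Z → Model d} {q : Z → Bool × Ξ} (hw : Measurable w) (hq : Measurable q) :
    Measurable fun z => contribution P c (w z) (q z) :=
  Measurable.ite (measurable_fst.comp hq (measurableSet_singleton true))
    (measurable_clientUpdate P c hw (measurable_snd.comp hq)) measurable_const

theorem norm_clip_le (v : Model d) {R : ℝ} (hR : 0 < R) : ‖clip v R‖ ≤ R := by
  have hm : 0 < max 1 (‖v‖ / R) := lt_max_of_lt_left one_pos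
  rw [clip, norm_smul, norm_inv, Real.norm_of_nonneg hm.le, inv_mul_le_iff₀ hm]
  calc ‖v‖ = ‖v‖ / R * R := (div_mul_cancel₀ _ hR.ne').symm
    _ ≤ max 1 (‖v‖ / R) * R := by gcongr; exact le_max_right _ _

/-- Clipping after every local step bounds the sensitivity to one client. -/
theorem norm_clientUpdate_le (P : Params d) (hR : 0 < P.clipRadius) (c : Client d Ξ)
    (w : Model d) (ξ : Ξ) : ‖clientUpdate P c w ξ‖ ≤ P.clipRadius := by
  unfold clientUpdate
  cases P.localSteps with
  | zero => simpa [localModel] using hR.le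
  | succ i =>
    rw [localModel, add_sub_cancel_left]
    exact norm_clip_le _ hR

/-- The sum of the contributions of all clients. -/
def aggregate (P : Params d) (client : C → Client d Ξ) (D : Finset C) (w : Model d)
    (f : D → Bool × Ξ) : Model d :=
  ∑ j : D, contribution P (client j) w (f j)

/-- One server step from the state `(w^t, ∑_{i ≤ t} a_i w^i)` with the noisy aggregate `y`. -/
def serverStep (P : Params d) (B : Matrix (Fin d) (Fin d) ℝ) (t : ℕ) (s : Model d × Model d)
    (y : Model d) : Model d × Model d :=
  (s.1 + (P.ηg / P.S t) • Matrix.toEuclideanLin B y,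
    s.2 + P.a (t + 1) • (s.1 + (P.ηg / P.S t) • Matrix.toEuclideanLin B y))

/-- One round, as a function of the state and of the randomness of the round. -/
def roundMap (P : Params d) (B : Matrix (Fin d) (Fin d) ℝ) (client : C → Client d Ξ)
    (D : Finset C) (t : ℕ) (q : (Model d × Model d) × Seed d Ξ D) : Model d × Model d :=
  serverStep P B t q.1 (aggregate P client D q.1.1 q.2.1 + q.2.2)

/-- The state `(w^t, ∑_{i ≤ t} a_i w^i)` after `t` rounds. -/
def state (P : Params d) (B : Matrix (Fin d) (Fin d) ℝ) (client : C → Client d Ξ)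
    (D : Finset C) (t : ℕ) (ω : ℕ → Seed d Ξ D) : Model d × Model d :=
  (globalModel P B client D ω t,
    ∑ i ∈ Finset.range (t + 1), P.a i • globalModel P B client D ω i)

@[fun_prop]
theorem measurable_serverStep (P : Params d) (B : Matrix (Fin d) (Fin d) ℝ) (t : ℕ) {Z : Type*}
    [MeasurableSpace Z] {s : Z → Model d × Model d} {y : Z → Model d} (hs : Measurable s)
    (hy : Measurable y) : Measurable fun z => serverStep P B t (s z) (y z) := by
  have hB : Measurable (Matrix.toEuclideanLin B) :=
    (Matrix.toEuclideanLin B).continuous_of_finiteDimensional.measurable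
  unfold serverStep
  fun_prop

@[fun_prop]
theorem measurable_aggregate (P : Params d) (client : C → Client d Ξ) (D : Finset C) {Z : Type*}
    [MeasurableSpace Z] {w : Z → Model d} {f : Z → D → Bool × Ξ} (hw : Measurable w)
    (hf : Measurable f) : Measurable fun z => aggregate P client D (w z) (f z) := by
  unfold aggregate
  fun_prop

@[fun_prop]
theorem measurable_roundMap (P : Params d) (B : Matrix (Fin d) (Fin d) ℝ)
    (client : C → Client d Ξ) (D : Finset C) (t : ℕ) :
    Measurable (roundMap P B client D t) := by
  unfold roundMap
  fun_prop

theorem measurable_state (P : Params d) (B : Matrix (Fin d) (Fin d) ℝ)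
    (client : C → Client d Ξ) (D : Finset C) (t : ℕ) : Measurable (state P B client D t) :=
  (measurable_globalModel P B client D t).prodMk <| Finset.measurable_sum _ fun i _ =>
    (measurable_globalModel P B client D i).const_smul (P.a i)

theorem state_succ (P : Params d) (B : Matrix (Fin d) (Fin d) ℝ) (client : C → Client d Ξ)
    (D : Finset C) (t : ℕ) (ω : ℕ → Seed d Ξ D) :
    state P B client D (t + 1) ω = roundMap P B client D t (state P B client D t ω, ω t) := by
  have h : globalModel P B client D ω (t + 1) =
      (roundMap P B client D t (state P B client D t ω, ω t)).1 := by
    simp only [globalModel, roundMap, serverStep, state, aggregate, contribution, activeClients,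
      Finset.sum_filter]
  rw [state, Finset.sum_range_succ, h]
  rfl

theorem state_congr (P : Params d) (B : Matrix (Fin d) (Fin d) ℝ) (client : C → Client d Ξ)
    (D : Finset C) (t : ℕ) {ω ω' : ℕ → Seed d Ξ D} (h : ∀ i < t, ω i = ω' i) :
    state P B client D t ω = state P B client D t ω' := by
  induction t with
  | zero => simp [state, globalModel]
  | succ t ih => rw [state_succ, state_succ, ih fun i hi => h i (by omega), h t (by omega)]

/-- The law of the state after `t` rounds. -/
def stateLaw (P : Params d) (B : Matrix (Fin d) (Fin d) ℝ) (client : C → Client d Ξ)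
    (D : Finset C) (t : ℕ) : Measure (Model d × Model d) :=
  (Measure.infinitePi fun _ : ℕ => seedLaw P client D).map (state P B client D t)

instance (P : Params d) (B : Matrix (Fin d) (Fin d) ℝ) (client : C → Client d Ξ)
    (D : Finset C) (t : ℕ) : IsProbabilityMeasure (stateLaw P B client D t) :=
  Measure.isProbabilityMeasure_map (measurable_state P B client D t).aemeasurable

theorem stateLaw_zero (P : Params d) (B : Matrix (Fin d) (Fin d) ℝ) (client : C → Client d Ξ)
    (D : Finset C) : stateLaw P B client D 0 = Measure.dirac (P.w₀, P.a 0 • P.w₀) := by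
  have : state P B client D 0 = fun _ => (P.w₀, P.a 0 • P.w₀) := by
    ext ω : 1; simp [state, globalModel]
  rw [stateLaw, this, Measure.map_const, measure_univ, one_smul]

/-- The state before a round is independent of the randomness of the round. -/
theorem indepFun_state (P : Params d) (B : Matrix (Fin d) (Fin d) ℝ) (client : C → Client d Ξ)
    (D : Finset C) (t : ℕ) :
    IndepFun (state P B client D t) (fun ω : ℕ → Seed d Ξ D => ω t)
      (Measure.infinitePi fun _ : ℕ => seedLaw P client D) := by
  obtain ⟨r₀⟩ : Nonempty (Seed d Ξ D) := nonempty_of_isProbabilityMeasure (seedLaw P client D)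
  have hi := (iIndepFun_infinitePi (P := fun _ : ℕ => seedLaw P client D)
    (X := fun _ r => r) fun _ => measurable_id).indepFun_finset (Finset.range t) {t}
    (by simp) fun i => measurable_pi_apply i
  -- the first `t` seeds determine the state, whatever the later ones are
  let ext : (Finset.range t → Seed d Ξ D) → ℕ → Seed d Ξ D := fun η i =>
    if h : i ∈ Finset.range t then η ⟨i, h⟩ else r₀
  have hext : Measurable ext := measurable_pi_lambda _ fun i => by
    by_cases h : i ∈ Finset.range t
    · simpa only [ext, h, dite_true] using measurable_pi_apply _
    · simpa only [ext, h, dite_false] using measurable_const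
  have hj := hi.comp ((measurable_state P B client D t).comp hext)
    (measurable_pi_apply (⟨t, Finset.mem_singleton_self t⟩ : ({t} : Finset ℕ)))
  have e : (state P B client D t ∘ ext) ∘ (fun (ω : ℕ → Seed d Ξ D) (i : Finset.range t) => ω i) =
      state P B client D t := by
    ext ω : 1
    exact state_congr P B client D t fun i hi => by simp [ext, hi]
  rw [e] at hj
  exact hj

theorem stateLaw_succ (P : Params d) (B : Matrix (Fin d) (Fin d) ℝ) (client : C → Client d Ξ)
    (D : Finset C) (t : ℕ) :
    stateLaw P B client D (t + 1) =
      ((stateLaw P B client D t).prod (seedLaw P client D)).map (roundMap P B client D t) := by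
  have hs := measurable_state P B client D t
  have h := (indepFun_iff_map_prod_eq_prod_map_map hs.aemeasurable
    (measurable_pi_apply t).aemeasurable).1 (indepFun_state P B client D t)
  have he := Measure.infinitePi_map_eval (fun _ : ℕ => seedLaw P client D) t
  rw [show (fun ω : ℕ → Seed d Ξ D => ω t) = Function.eval t from rfl, he] at h
  rw [stateLaw, stateLaw, ← h, Measure.map_map (measurable_roundMap P B client D t)
    (hs.prodMk (measurable_pi_apply t))]
  congr 1
  ext ω : 1
  exact state_succ P B client D t ω

theorem outputLaw_eq_map_stateLaw (P : Params d) (B : Matrix (Fin d) (Fin d) ℝ)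
    (client : C → Client d Ξ) (D : Finset C) :
    outputLaw P B client D = (stateLaw P B client D P.T).map Prod.snd := by
  rw [stateLaw, Measure.map_map measurable_snd (measurable_state P B client D P.T)]
  rfl

/-! ### Adding one client -/

/-- Extension of a family on `ι` by one more value, along an enumeration `e` of the larger index
type. -/
def extendFamily {ι κ X : Type*} (e : Option ι ≃ κ) (p : (ι → X) × X) (k : κ) : X :=
  (e.symm k).elim p.2 p.1

theorem measurable_extendFamily {ι κ X : Type*} [MeasurableSpace X] (e : Option ι ≃ κ) :
    Measurable (extendFamily (X := X) e) := by
  refine measurable_pi_lambda _ fun k => ?_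
  unfold extendFamily
  cases e.symm k with
  | none => exact measurable_snd
  | some i => exact (measurable_pi_apply i).comp measurable_fst

theorem map_extendFamily {ι κ X : Type*} [Fintype ι] [Fintype κ] [MeasurableSpace X]
    (e : Option ι ≃ κ) (μ : κ → Measure X) [∀ k, IsProbabilityMeasure (μ k)] :
    ((Measure.pi fun i => μ (e (some i))).prod (μ (e none))).map (extendFamily e) =
      Measure.pi μ := by
  refine (Measure.pi_eq fun s hs => ?_).symm
  have hpre : extendFamily e ⁻¹' Set.univ.pi s =
      (Set.univ.pi fun i => s (e (some i))) ×ˢ s (e none) := by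
    ext p
    simp only [Set.mem_preimage, Set.mem_univ_pi, Set.mem_prod]
    rw [← e.forall_congr_right, Option.forall, and_comm]
    simp [extendFamily]
  rw [Measure.map_apply (measurable_extendFamily e) (.univ_pi hs), hpre, Measure.prod_prod,
    Measure.pi_pi, ← e.prod_comp, Fintype.prod_option, mul_comm]

theorem lintegral_bernoulliMeasure {X : Type*} [MeasurableSpace X] {x y : X} (p : unitInterval)
    {f : X → ENNReal} (hf : Measurable f) :
    ∫⁻ z, f z ∂bernoulliMeasure x y p =
      ENNReal.ofReal p * f x + ENNReal.ofReal (1 - p) * f y := by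
  rw [bernoulliMeasure_def, lintegral_add_measure, lintegral_smul_measure, lintegral_smul_measure,
    lintegral_dirac' _ hf, lintegral_dirac' _ hf, ENNReal.smul_def, ENNReal.smul_def, smul_eq_mul,
    smul_eq_mul]
  congr 2
  · rw [ENNReal.ofReal, Real.toNNReal_of_nonneg p.2.1]; rfl
  · rw [ENNReal.ofReal, Real.toNNReal_of_nonneg (sub_nonneg.2 p.2.2)]; rfl

/-- The clients of `insert a D` are those of `D` and one more. -/
def insertEquiv {D D' : Finset C} {a : C} (ha : a ∉ D) (hD : ∀ j, j ∈ D' ↔ j = a ∨ j ∈ D) :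
    Option D ≃ D' :=
  Equiv.ofBijective
    (fun o => o.elim ⟨a, (hD a).2 (.inl rfl)⟩ fun j => ⟨j, (hD j).2 (.inr j.2)⟩) <| by
    constructor
    · rintro (_ | i) (_ | j) h
      · rfl
      · have h' : a = j := congrArg Subtype.val h
        exact absurd (h' ▸ j.2) ha
      · have h' : (i : C) = a := congrArg Subtype.val h
        exact absurd (h' ▸ i.2) ha
      · have h' : (i : C) = j := congrArg (fun k : D' => (k : C)) h
        exact congrArg some (Subtype.ext h')
    · rintro ⟨j, hj⟩
      rcases (hD j).1 hj with rfl | h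
      · exact ⟨none, rfl⟩
      · exact ⟨some ⟨j, h⟩, rfl⟩

section Insert

variable (P : Params d) (B : Matrix (Fin d) (Fin d) ℝ) (client : C → Client d Ξ)
  {D D' : Finset C} {a : C} (ha : a ∉ D) (hD : ∀ j, j ∈ D' ↔ j = a ∨ j ∈ D)

theorem aggregate_extendFamily (w : Model d) (f : D → Bool × Ξ) (q : Bool × Ξ) :
    aggregate P client D' w (extendFamily (insertEquiv ha hD) (f, q)) =
      aggregate P client D w f + contribution P (client a) w q := by
  rw [aggregate, ← (insertEquiv ha hD).sum_comp, Fintype.sum_option, add_comm]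
  simp only [extendFamily, Equiv.symm_apply_apply]
  rfl

/-- Integration over the choices of the clients of `D'` is integration over those of `D` and
of `a`. -/
theorem lintegral_pi_insert {φ : (D' → Bool × Ξ) → ENNReal} (hφ : Measurable φ) :
    ∫⁻ k, φ k ∂(Measure.pi fun j : D' =>
        (bernoulliMeasure true false P.τ).prod ((client j).batchLaw : Measure Ξ)) =
      ∫⁻ f, ∫⁻ q, φ (extendFamily (insertEquiv ha hD) (f, q))
        ∂((bernoulliMeasure true false P.τ).prod ((client a).batchLaw : Measure Ξ))
        ∂(Measure.pi fun j : D =>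
          (bernoulliMeasure true false P.τ).prod ((client j).batchLaw : Measure Ξ)) := by
  have he := measurable_extendFamily (X := Bool × Ξ) (insertEquiv ha hD)
  rw [← lintegral_prod (fun p => φ (extendFamily (insertEquiv ha hD) p)) (by fun_prop),
    ← lintegral_map hφ he]
  congr 1
  exact (map_extendFamily (insertEquiv ha hD) fun j : D' =>
    (bernoulliMeasure true false P.τ).prod ((client j).batchLaw : Measure Ξ)).symm

/-- The randomness of a round shared by the runs on `D` and on `insert a D`: the choices of the
clients of `D`, the mini-batches of `a`, and a Gaussian vector. Whether `a` is active is not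
recorded; it is averaged into the likelihood ratio of the Gaussian vector. -/
def sharedLaw (P : Params d) (client : C → Client d Ξ) (D : Finset C) (a : C) :
    Measure ((D → Bool × Ξ) × Ξ × Model d) :=
  (Measure.pi fun j : D =>
    (bernoulliMeasure true false P.τ).prod ((client j).batchLaw : Measure Ξ)).prod
      (((client a).batchLaw : Measure Ξ).prod (gaussianNoise d P.ν))

instance (P : Params d) (client : C → Client d Ξ) (D : Finset C) (a : C) :
    IsProbabilityMeasure (sharedLaw P client D a) := by
  unfold sharedLaw; infer_instance

/-- A round without the client `a`, in terms of the shared randomness. -/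
theorem lintegral_roundMap (t : ℕ) (s : Model d × Model d) {f : Model d × Model d → ENNReal}
    (hf : Measurable f) :
    ∫⁻ r, f (roundMap P B client D t (s, r)) ∂seedLaw P client D =
      ∫⁻ z, f (roundMap P B client D t (s, (z.1, z.2.2))) ∂sharedLaw P client D a := by
  have h1 : Measurable fun r : Seed d Ξ D => f (roundMap P B client D t (s, r)) := by fun_prop
  have h2 : Measurable fun z : (D → Bool × Ξ) × Ξ × Model d =>
      f (roundMap P B client D t (s, (z.1, z.2.2))) := by fun_prop
  rw [seedLaw, sharedLaw, lintegral_prod _ h1.aemeasurable, lintegral_prod _ h2.aemeasurable]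
  refine lintegral_congr fun g => ?_
  have h3 : Measurable fun z : Ξ × Model d => f (roundMap P B client D t (s, (g, z.2))) := by
    fun_prop
  rw [lintegral_prod _ h3.aemeasurable]
  simp

/-- Subsampling a translation of the Gaussian noise: averaging over the activity of the client
puts the mixture ratio as a density. -/
theorem lintegral_bernoulli_gaussianNoise {τ : unitInterval} {ν : ℝ} (hν : ν ≠ 0)
    (hτ : (τ : ℝ) < 1) (Δ : Model d) {g : Model d → ENNReal} (hg : Measurable g) :
    ENNReal.ofReal τ * ∫⁻ y, g (Δ + y) ∂gaussianNoise d ν +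
        ENNReal.ofReal (1 - τ) * ∫⁻ y, g y ∂gaussianNoise d ν =
      ∫⁻ y, ENNReal.ofReal (Real.exp (mixtureLogRatio τ ν Δ y)) * g y ∂gaussianNoise d ν := by
  have hr := (measurable_likelihoodRatio_right ν Δ).ennreal_ofReal
  rw [← lintegral_map hg (measurable_const_add Δ), map_add_gaussianNoise hν,
    lintegral_withDensity_eq_lintegral_mul _ hr hg, ← lintegral_const_mul _ (hr.mul hg),
    ← lintegral_const_mul _ hg, ← lintegral_add_left ((hr.mul hg).const_mul _)]
  refine lintegral_congr fun y => ?_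
  have h0 := likelihoodRatio_pos ν Δ y
  have h1 := mul_nonneg τ.2.1 h0.le
  have hpos : 0 < 1 + τ * (likelihoodRatio ν Δ y - 1) := by linarith
  rw [mixtureLogRatio, Real.exp_log hpos, Pi.mul_apply, ← mul_assoc, ← add_mul,
    ← ENNReal.ofReal_mul τ.2.1, ← ENNReal.ofReal_add h1 (by linarith)]
  congr 2
  ring

/-- A noisy contribution of a subsampled client, averaged over its activity. -/
theorem lintegral_contribution (c : Client d Ξ) (hν : P.ν ≠ 0) (hτ : (P.τ : ℝ) < 1) (w : Model d)
    {g : Model d → ENNReal} (hg : Measurable g) :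
    ∫⁻ q, ∫⁻ n, g (contribution P c w q + n) ∂gaussianNoise d P.ν
        ∂(bernoulliMeasure true false P.τ).prod (c.batchLaw : Measure Ξ) =
      ∫⁻ ξ, ∫⁻ y, ENNReal.ofReal (Real.exp (mixtureLogRatio P.τ P.ν (clientUpdate P c w ξ) y)) * g y
        ∂gaussianNoise d P.ν ∂(c.batchLaw : Measure Ξ) := by
  have hm : Measurable fun q : Bool × Ξ =>
      ∫⁻ n, g (contribution P c w q + n) ∂gaussianNoise d P.ν :=
    Measurable.lintegral_prod_right'
      (f := fun z : (Bool × Ξ) × Model d => g (contribution P c w z.1 + z.2)) (by fun_prop)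
  rw [lintegral_prod_symm _ hm.aemeasurable]
  refine lintegral_congr fun ξ => ?_
  rw [lintegral_bernoulliMeasure _ (measurable_of_finite _),
    ← lintegral_bernoulli_gaussianNoise hν hτ _ hg]
  simp [contribution]

include ha hD in
/-- A round with the additional client `a`, in terms of the shared randomness. -/
theorem lintegral_roundMap_insert (hν : P.ν ≠ 0) (hτ : (P.τ : ℝ) < 1) (t : ℕ)
    (s : Model d × Model d) {f : Model d × Model d → ENNReal} (hf : Measurable f) :
    ∫⁻ r, f (roundMap P B client D' t (s, r)) ∂seedLaw P client D' =
      ∫⁻ z, ENNReal.ofReal (Real.exp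
          (mixtureLogRatio P.τ P.ν (clientUpdate P (client a) s.1 z.2.1) z.2.2)) *
        f (roundMap P B client D t (s, (z.1, z.2.2))) ∂sharedLaw P client D a := by
  have hL : Measurable fun q : Seed d Ξ D' => f (roundMap P B client D' t (s, q)) := by fun_prop
  have hR : Measurable fun z : (D → Bool × Ξ) × Ξ × Model d => ENNReal.ofReal (Real.exp
      (mixtureLogRatio P.τ P.ν (clientUpdate P (client a) s.1 z.2.1) z.2.2)) *
        f (roundMap P B client D t (s, (z.1, z.2.2))) := by
    fun_prop
  rw [seedLaw, lintegral_prod _ hL.aemeasurable,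
    lintegral_pi_insert P client ha hD hL.lintegral_prod_right', sharedLaw,
    lintegral_prod _ hR.aemeasurable]
  refine lintegral_congr fun g => ?_
  have hRg : Measurable fun z : Ξ × Model d => ENNReal.ofReal (Real.exp
      (mixtureLogRatio P.τ P.ν (clientUpdate P (client a) s.1 z.1) z.2)) *
        f (roundMap P B client D t (s, (g, z.2))) := by
    fun_prop
  rw [lintegral_prod _ hRg.aemeasurable]
  refine Eq.trans ?_ (lintegral_contribution P (client a) hν hτ s.1
    (g := fun y => f (roundMap P B client D t (s, (g, y)))) (by fun_prop))
  simp only [roundMap, aggregate_extendFamily, add_assoc]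

include ha hD in
/-- Conditionally on the current state, every round has the likelihood ratio of the subsampled
Gaussian mechanism, so `t` rounds multiply the moment bound of one round `t` times. -/
theorem privacyLossBound_stateLaw {α x : ℝ} (h : SubsamplingRegime P.τ α x) (hν : P.ν ≠ 0)
    (hR : 0 < P.clipRadius) (hx : P.clipRadius ^ 2 / P.ν ^ 2 ≤ x) (t : ℕ) :
    PrivacyLossBound α (ENNReal.ofReal (Real.exp (2 * α * (α - 1) * (P.τ : ℝ) ^ 2 * x)) ^ t)
      (stateLaw P B client D' t) (stateLaw P B client D t) := by
  induction t with
  | zero =>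
    rw [stateLaw_zero, stateLaw_zero, pow_zero]
    exact .dirac α _
  | succ t ih =>
    let ℓ : (Model d × Model d) × (D → Bool × Ξ) × Ξ × Model d → ℝ := fun q =>
      mixtureLogRatio P.τ P.ν (clientUpdate P (client a) q.1.1 q.2.2.1) q.2.2.2
    let F : (Model d × Model d) × (D → Bool × Ξ) × Ξ × Model d → Model d × Model d := fun q =>
      roundMap P B client D t (q.1, (q.2.1, q.2.2.2))
    have hℓ : Measurable ℓ := by fun_prop
    have hF : Measurable F := by fun_prop
    have hΔ : ∀ w ξ, ‖clientUpdate P (client a) w ξ‖ ^ 2 / P.ν ^ 2 ≤ x := fun w ξ => by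
      refine le_trans ?_ hx
      gcongr
      exact norm_clientUpdate_le P hR _ w ξ
    have hmom : ∀ p c, (∀ w ξ, ∫⁻ y, ENNReal.ofReal (Real.exp
        (p * mixtureLogRatio P.τ P.ν (clientUpdate P (client a) w ξ) y)) ∂gaussianNoise d P.ν ≤ c) →
        ∀ s, ∫⁻ z, ENNReal.ofReal (Real.exp (p * ℓ (s, z))) ∂sharedLaw P client D a ≤ c := by
      intro p c hpc s
      have hm : Measurable fun z : (D → Bool × Ξ) × Ξ × Model d =>
          ENNReal.ofReal (Real.exp (p * ℓ (s, z))) := by fun_prop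
      rw [sharedLaw, lintegral_prod _ hm.aemeasurable]
      refine (lintegral_mono (g := fun _ => c) fun g => ?_).trans (by simp)
      rw [lintegral_prod _ (by fun_prop)]
      exact (lintegral_mono (g := fun _ => c) fun ξ => hpc s.1 ξ).trans (by simp)
    rw [pow_succ]
    refine ih.step (sharedLaw P client D a) hF hℓ
      (hmom α _ fun w ξ => h.lintegral_exp_mixtureLogRatio_le hν (hΔ w ξ))
      (hmom (1 - α) _ fun w ξ => h.lintegral_exp_mixtureLogRatio_le' hν (hΔ w ξ)) ?_ ?_
    · intro f hf
      rw [stateLaw_succ, lintegral_map hf (measurable_roundMap P B client D t),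
        lintegral_prod _ (by fun_prop)]
      exact lintegral_congr fun s => lintegral_roundMap P B client t s hf
    · intro f hf
      rw [stateLaw_succ, lintegral_map hf (measurable_roundMap P B client D' t),
        lintegral_prod _ (by fun_prop)]
      exact lintegral_congr fun s =>
        lintegral_roundMap_insert P B client ha hD hν h.τ_lt_one t s hf

end Insert

/-! ### Calibration of the noise -/

theorem Adjacent.eq_or_insert {D D' : Finset C} (h : Adjacent D D') :
    D = D' ∨ (∃ a ∉ D, ∀ j, j ∈ D' ↔ j = a ∨ j ∈ D) ∨ ∃ a ∉ D', ∀ j, j ∈ D ↔ j = a ∨ j ∈ D' := by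
  classical
  obtain ⟨a, rfl | rfl⟩ := h
  · by_cases ha : a ∈ D
    · left; ext j; simp only [Finset.mem_insert]; grind
    · exact .inr (.inl ⟨a, ha, fun j => by simp⟩)
  · by_cases ha : a ∈ D
    · refine .inr (.inr ⟨a, by simp, fun j => ?_⟩)
      simp only [Finset.mem_erase]; grind
    · left; ext j; simp only [Finset.mem_erase]; grind

/-- Privacy of the procedure with an arbitrary matrix `B`: the noisy aggregate of every round is
private, and `B` acts on it afterwards. -/
theorem isDP_outputLaw (P : Params d) (B : Matrix (Fin d) (Fin d) ℝ) (client : C → Client d Ξ)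
    {α x ε δ : ℝ} (hε : 0 ≤ ε) (h : SubsamplingRegime P.τ α x) (hν : P.ν ≠ 0)
    (hR : 0 < P.clipRadius) (hx : P.clipRadius ^ 2 / P.ν ^ 2 ≤ x)
    (hδ : Real.exp (-((α - 1) * ε)) *
      Real.exp (2 * α * (α - 1) * (P.τ : ℝ) ^ 2 * x) ^ P.T ≤ δ) :
    IsDP (outputLaw P B client) ε δ := by
  have hδ' : ENNReal.ofReal (Real.exp (-((α - 1) * ε))) *
      ENNReal.ofReal (Real.exp (2 * α * (α - 1) * (P.τ : ℝ) ^ 2 * x)) ^ P.T ≤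
        ENNReal.ofReal δ := by
    rw [← ENNReal.ofReal_pow (Real.exp_pos _).le, ← ENNReal.ofReal_mul (Real.exp_pos _).le]
    exact ENNReal.ofReal_le_ofReal hδ
  intro D D' hadj O hO
  rw [outputLaw_eq_map_stateLaw, outputLaw_eq_map_stateLaw, Measure.map_apply measurable_snd hO,
    Measure.map_apply measurable_snd hO]
  have hO' : MeasurableSet (Prod.snd ⁻¹' O : Set (Model d × Model d)) := measurable_snd hO
  rcases hadj.eq_or_insert with rfl | ⟨a, ha, hD⟩ | ⟨a, ha, hD⟩
  · refine le_add_of_le_of_nonneg (le_mul_of_one_le_left' ?_) zero_le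
    rw [ENNReal.one_le_ofReal]
    exact Real.one_le_exp hε
  · have := privacyLossBound_stateLaw P B client ha hD h hν hR hx P.T
    exact (this.le h.one_lt.le ε hO').2.trans (add_le_add_right hδ' _)
  · have := privacyLossBound_stateLaw P B client ha hD h hν hR hx P.T
    exact (this.le h.one_lt.le ε hO').1.trans (add_le_add_right hδ' _)

/-- The condition on the order `α`, solved for the sampling ratio, with `x = 𝓛² / ν²`. -/
theorem subsamplingRegime_of_le {τ α ν R : ℝ} (hτ : 0 < τ) (hα : 1 < α) (hR : 0 < R)
    (hνR : ν ^ 2 / R ^ 2 ≥ 5 / 9)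
    (h : α - 1 ≤ 2 * ν ^ 2 / (3 * R ^ 2) * Real.log (1 / (τ * α * (1 + ν ^ 2 / R ^ 2)))) :
    SubsamplingRegime τ α (R ^ 2 / ν ^ 2) := by
  have hν2 : 0 < ν ^ 2 := by
    by_contra hn
    have : ν ^ 2 = 0 := le_antisymm (not_lt.1 hn) (sq_nonneg ν)
    rw [this] at hνR; norm_num at hνR
  have hR2 : 0 < R ^ 2 := by positivity
  set x := R ^ 2 / ν ^ 2 with hx
  have hx0 : 0 < x := by positivity
  have e1 : ν ^ 2 / R ^ 2 = 1 / x := by rw [hx, one_div_div]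
  have e2 : 2 * ν ^ 2 / (3 * R ^ 2) = 2 / (3 * x) := by rw [hx]; field_simp
  rw [e1] at hνR
  rw [e1, e2] at h
  have hX : 0 < τ * α * (1 + 1 / x) := by positivity
  refine ⟨hx0, ?_, hα, hτ, ?_⟩
  · rw [ge_iff_le, div_le_div_iff₀ (by norm_num) hx0] at hνR
    linarith
  · rw [one_div (τ * α * _), Real.log_inv, div_mul_eq_mul_div, le_div_iff₀ (by positivity)] at h
    have hlog : Real.log (τ * α * (1 + 1 / x)) ≤ -(3 * (α - 1) * x / 2) := by linarith
    have := (Real.log_le_iff_le_exp hX).1 hlog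
    have e3 : x / (1 + x) / α * (τ * α * (1 + 1 / x)) = τ := by field_simp; ring
    calc τ = x / (1 + x) / α * (τ * α * (1 + 1 / x)) := e3.symm
      _ ≤ _ := by gcongr

/-- The lower bound on the noise level makes the `T`-fold composed moment bound compatible with
the target `(ε, δ)`. -/
theorem calibration {τ R ε δ ν l α : ℝ} {T : ℕ} (hε : 0 < ε) (hδ : δ ∈ Set.Ioo (0 : ℝ) 1)
    (hτ : 0 < τ) (hR : 0 < R) (hν0 : 0 < ν ^ 2) (hl : l ∈ Set.Ioo (0 : ℝ) 1)
    (hα : α = Real.log (1 / δ) / ((1 - l) * ε) + 1)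
    (hν : ν ≥ τ * R / ε * Real.sqrt (2 * T / l * (Real.log (1 / δ) / (1 - l) + ε))) :
    Real.exp (-((α - 1) * ε)) *
      Real.exp (2 * α * (α - 1) * τ ^ 2 * (R ^ 2 / ν ^ 2)) ^ T ≤ δ := by
  have hlog : 0 < Real.log (1 / δ) := Real.log_pos ((one_lt_div hδ.1).2 hδ.2)
  have hl1 : 0 < 1 - l := sub_pos.2 hl.2
  have hl0 : 0 < l := hl.1
  have hα1 : 0 < α - 1 := by rw [hα, add_sub_cancel_right]; positivity
  have hαε : Real.log (1 / δ) / (1 - l) + ε = α * ε := by rw [hα]; field_simp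
  have hδα : (α - 1) * ((1 - l) * ε) = Real.log (1 / δ) := by
    rw [hα, add_sub_cancel_right]; field_simp
  rw [hαε] at hν
  have harg : 0 ≤ 2 * T / l * (α * ε) := by
    have : 0 ≤ α := by linarith
    positivity
  have hsq : (τ * R / ε) ^ 2 * (2 * T / l * (α * ε)) ≤ ν ^ 2 := by
    have := pow_le_pow_left₀ (by positivity) hν 2
    rwa [mul_pow, Real.sq_sqrt harg] at this
  have hT : T * (2 * α * τ ^ 2 * (R ^ 2 / ν ^ 2)) ≤ l * ε := by
    have e : (τ * R / ε) ^ 2 * (2 * T / l * (α * ε)) =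
        T * (2 * α * τ ^ 2 * R ^ 2) / (l * ε) := by field_simp
    rw [e, div_le_iff₀ (by positivity)] at hsq
    have e' : T * (2 * α * τ ^ 2 * (R ^ 2 / ν ^ 2)) = T * (2 * α * τ ^ 2 * R ^ 2) / ν ^ 2 := by
      ring
    rw [e', div_le_iff₀ hν0]
    linarith
  rw [← Real.exp_nat_mul, ← Real.exp_add, ← Real.le_log_iff_exp_le hδ.1]
  have hlogδ : Real.log δ = -Real.log (1 / δ) := by rw [one_div, Real.log_inv, neg_neg]
  rw [hlogδ, ← hδα]
  nlinarith [mul_le_mul_of_nonneg_right hT hα1.le]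

end DPFedLS

end

theorem mainTheorem2 {d : ℕ} {Ξ : Type*} [MeasurableSpace Ξ] {C : Type*}
    (client : C → DPFedLS.Client d Ξ) (P : DPFedLS.Params d) (ε δ : ℝ)
    (hε : 0 < ε) (hδ : δ ∈ Set.Ioo (0 : ℝ) 1)
    (hτ : 0 < (P.τ : ℝ)) (hclip : 0 < P.clipRadius) (hS : ∀ t < P.T, 0 < P.S t)
    (ha : ∀ t ≤ P.T, P.a t ∈ Set.Icc (0 : ℝ) 1)
    (hsum : ∑ t ∈ Finset.range (P.T + 1), P.a t = 1)
    (hν : ∃ l ∈ Set.Ioo (0 : ℝ) 1, ∃ α : ℝ, α = Real.log (1 / δ) / ((1 - l) * ε) + 1 ∧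
      P.ν ≥ P.τ * P.clipRadius / ε *
        Real.sqrt (2 * P.T / l * (Real.log (1 / δ) / (1 - l) + ε)) ∧
      P.ν ^ 2 / P.clipRadius ^ 2 ≥ 5 / 9 ∧
      α - 1 ≤ 2 * P.ν ^ 2 / (3 * P.clipRadius ^ 2) *
        Real.log (1 / (P.τ * α * (1 + P.ν ^ 2 / P.clipRadius ^ 2)))) :
    DPFedLS.IsDP (DPFedLS.dpFed P client) ε δ ∧
      ∀ σ : ℝ, 0 ≤ σ → DPFedLS.IsDP (DPFedLS.dpFedLS P σ client) ε δ := by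
  obtain ⟨l, hl, α, hα, hνlow, hratio, horder⟩ := hν
  have hlog : 0 < Real.log (1 / δ) := Real.log_pos ((one_lt_div hδ.1).2 hδ.2)
  have hl1 : 0 < 1 - l := sub_pos.2 hl.2
  have hα1 : 1 < α := by rw [hα]; linarith [div_pos hlog (mul_pos hl1 hε)]
  have hν0 : P.ν ≠ 0 := by
    intro h0
    rw [h0] at hratio
    norm_num at hratio
  have hreg := DPFedLS.subsamplingRegime_of_le hτ hα1 hclip hratio horder
  have hcal := DPFedLS.calibration hε hδ hτ hclip (by positivity) hl hα hνlow
  have key : ∀ B, DPFedLS.IsDP (DPFedLS.outputLaw P B client) ε δ := fun B =>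
    DPFedLS.isDP_outputLaw P B client hε.le hreg hν0 hclip le_rfl hcal
  exact ⟨key 1, fun σ _ => key _⟩
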